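/- Let $m\ge 0$ be an integer. For $z\in\mathbb C\setminus\{-1,-2,\dots\}$ let $t_\pm^z$ be the distributions on $\mathbb R$ obtained by analytic continuation in $z$ from the locally integrable functions ($\operatorname{Re}z>-1$) $t_+^z=t^z$ for $t>0$, $0$ for $t\le 0$, and $t_-^z=|t|^z$ for $t<0$, $0$ for $t\ge 0$; put $(2t)_\pm^z=2^z t_\pm^z$. For $k\ge 1$ let $t^{-k}$ be the distribution that is the value at $z=-k$ (a removable singularity) of $t_+^z+(-1)^k t_-^z$. Let $L$ be a contour from $\gamma-i\infty$ to $\gamma+i\infty$ that crosses the real axis exactly once, at a point $s$, where $\gamma>-1$ and $-m-1<s<-m$; let $L_0$ be a contour from $\gamma_0-i\infty$ to $\gamma_0+i\infty$ that crosses the real axis exactly once, at a point $s_0$, where $\gamma_0>-1$ and $-1<s_0<0$. (Contours are piecewise $C^1$, with real part tending to $\gamma$, resp. $\gamma_0$, at both ends, and have a parametrization with bounded speed along which $|\operatorname{Im}|$ grows at least linearly.) Define distributions on $\mathbb R$, by pairing the integrand with a test function in $C_c^\infty(\mathbb R)$ and then integrating over $\lambda$, $$\Phi_m^+=\frac1{2\pi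 i}\int_{L_0}\frac{\Gamma(-\lambda)}{\Gamma(\lambda+1+m)}(2t)_+^\lambda\,d\lambda,\qquad \Phi_m=\frac1{2\pi i}\int_{L_0}\frac{\Gamma(-\lambda)}{\Gamma(\lambda+1+m)}\Bigl(\frac{(2t)_+^\lambda}{\tan\pi\lambda}+\frac{(2t)_-^\lambda}{\sin\pi\lambda}\Bigr)d\lambda,$$ and let $\Psi_m^+$, $\Psi_m$ be given by the same two formulas with $L$ in place of $L_0$. All these integrals converge absolutely against every test function, the limits defining $t^{-k}$ exist, and: 1) $\Phi_m^+$ and $\Phi_m$ are locally integrable functions on $\mathbb R$; moreover $\Phi_m^+(t)|t|^{-\varepsilon}$ and $\Phi_m(t)|t|^{-\varepsilon}$ are locally integrable for all sufficiently small $\varepsilon>0$. 2) As distributions on $\mathbb R$, $$\Psi_m^+=\Phi_m^+-\sum_{k=1}^m\frac{(-1)^{k-1}}{2^k(m-k)!}\,\delta^{(k-1)},\qquad \Psi_m=\Phi_m-\frac1\pi\sum_{k=1}^m\frac{(k-1)!}{2^k(m-k)!}\,t^{-k}.$$ In particular, $\Psi_m^+$ (for $m\ge1$) extends to a continuous linear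 functional on the space $C_c^{m-1}(\mathbb R)$ of compactly supported $C^{m-1}$ functions, and $\Psi_m$ extends to a continuous linear functional on $C_c^{m}(\mathbb R)$. -/

import Mathlib

open MeasureTheory Filter Topology
open scoped Distributions

noncomputable section

namespace MellinBarnes

/-- The Riesz distribution `x_+^z` paired with a (smooth, compactly supported) `φ`. For
`-1 < Re z` we have `n = 0` and this is `∫_{x > 0} x^z φ(x) dx`; in general it is the analytic
continuation in `z`, written out by integrating by parts `n = ⌊-Re z⌋₊` times, so that
`-1 < Re (z + n)`:
`⟨x_+^z, φ⟩ = (-1)^n / ((z+1)(z+2)⋯(z+n)) · ∫_{x > 0} x^{z+n} φ^{(n)}(x) dx`.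
It is meaningful for `z ≠ -1, -2, …`, where the continuation has its simple poles. -/
def rieszPlus (z : ℂ) (φ : ℝ → ℂ) : ℂ :=
  ((-1 : ℂ) ^ ⌊-z.re⌋₊ / ∏ j ∈ Finset.range ⌊-z.re⌋₊, (z + (j : ℂ) + 1)) *
    ∫ x in Set.Ioi (0 : ℝ), (x : ℂ) ^ (z + (⌊-z.re⌋₊ : ℂ)) * iteratedDeriv ⌊-z.re⌋₊ φ x

/-- The Riesz distribution `x_-^z`, the reflection of `x_+^z`. -/
def rieszMinus (z : ℂ) (φ : ℝ → ℂ) : ℂ :=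
  rieszPlus z (fun x => φ (-x))

/-- The derivative `δ^{(j)}` of the Dirac delta at `0`. -/
def diracDeriv (j : ℕ) (φ : ℝ → ℂ) : ℂ :=
  (-1 : ℂ) ^ j * iteratedDeriv j φ 0

/-- The family `z ↦ x_+^z + (-1)^k x_-^z`, whose poles at `z = -k` cancel. -/
def rieszSum (k : ℕ) (z : ℂ) (φ : ℝ → ℂ) : ℂ :=
  rieszPlus z φ + (-1 : ℂ) ^ k * rieszMinus z φ

/-- The distribution `x^{-k}`: the value at `z = -k` (a removable singularity) of
`x_+^z + (-1)^k x_-^z`. -/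
def invPow (k : ℕ) (φ : ℝ → ℂ) : ℂ :=
  limUnder (𝓝[≠] (-(k : ℂ))) (fun z => rieszSum k z φ)

/-- `L` parametrizes a piecewise `C¹` contour from `γ - i∞` to `γ + i∞` which passes the real axis
exactly once, from below to above, at the point `s` (at parameter `0`). The last two conditions
and `bounded_deriv` say that the contour runs to `γ ± i∞`, with a parameter that is comparable to
`Im` near infinity. -/
structure IsContour (γ s : ℝ) (L : ℝ → ℂ) : Prop where
  continuous : Continuous L
  piecewise_contDiff : ∃ P : Set ℝ, P.Finite ∧ ∀ τ, τ ∉ P → ContDiffAt ℝ 1 L τ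
  bounded_deriv : ∃ C : ℝ, ∀ τ, ‖deriv L τ‖ ≤ C
  zero : L 0 = (s : ℂ)
  im_pos : ∀ τ, 0 < τ → 0 < (L τ).im
  im_neg : ∀ τ, τ < 0 → (L τ).im < 0
  tendsto_re : Tendsto (fun τ => (L τ).re) (cocompact ℝ) (𝓝 γ)
  im_growth : ∃ c : ℝ, 0 < c ∧ ∀ᶠ τ in cocompact ℝ, c * |τ| ≤ |(L τ).im|

/-- The factor `Γ(-z) / Γ(z + 1 + m)`. -/
def gammaRatio (m : ℕ) (z : ℂ) : ℂ :=
  Complex.Gamma (-z) / Complex.Gamma (z + 1 + (m : ℂ))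

/-- The distribution `Γ(-z) / Γ(z+1+m) · (2t)_+^z`, where `(2t)_+^z = 2^z t_+^z`. -/
def kernelPlus (m : ℕ) (φ : ℝ → ℂ) (z : ℂ) : ℂ :=
  gammaRatio m z * ((2 : ℂ) ^ z * rieszPlus z φ)

/-- The distribution `Γ(-z) / Γ(z+1+m) · ((2t)_+^z / tan(πz) + (2t)_-^z / sin(πz))`. -/
def kernel (m : ℕ) (φ : ℝ → ℂ) (z : ℂ) : ℂ :=
  gammaRatio m z *
    ((2 : ℂ) ^ z * rieszPlus z φ / Complex.tan (Real.pi * z) +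
      (2 : ℂ) ^ z * rieszMinus z φ / Complex.sin (Real.pi * z))

/-- Absolute convergence of `∫_L F(z) dz`. -/
def ContourIntegrable (L : ℝ → ℂ) (F : ℂ → ℂ) : Prop :=
  Integrable (fun τ : ℝ => F (L τ) * deriv L τ)

/-- `(1 / 2πi) ∫_L F(z) dz`. -/
def contourIntegral (L : ℝ → ℂ) (F : ℂ → ℂ) : ℂ :=
  1 / (2 * Real.pi * Complex.I) * ∫ τ : ℝ, F (L τ) * deriv L τ

/-- The Mellin–Barnes integral `(1 / 2πi) ∫_L Γ(-z)/Γ(z+1+m) (2t)_+^z dz` of distributions.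
It is `Φ_m^+` if `L` passes the real axis in `(-1, 0)`, and `Ψ_m^+` if `L` passes it in
`(-m-1, -m)`. -/
def besselPlus (m : ℕ) (L : ℝ → ℂ) (φ : ℝ → ℂ) : ℂ :=
  contourIntegral L (kernelPlus m φ)

/-- The Mellin–Barnes integral
`(1 / 2πi) ∫_L Γ(-z)/Γ(z+1+m) ((2t)_+^z / tan(πz) + (2t)_-^z / sin(πz)) dz` of distributions.
It is `Φ_m` if `L` passes the real axis in `(-1, 0)`, and `Ψ_m` if `L` passes it in
`(-m-1, -m)`. -/
def bessel (m : ℕ) (L : ℝ → ℂ) (φ : ℝ → ℂ) : ℂ :=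
  contourIntegral L (kernel m φ)

/-- The functional `T` on test functions is given by a locally integrable function `f`, and
`f(t) |t|^{-ε}` is locally integrable too for all sufficiently small `ε > 0`. -/
def IsLocallyIntegrableWithPower (T : (ℝ → ℂ) → ℂ) : Prop :=
  ∃ f : ℝ → ℂ, LocallyIntegrable f volume ∧
    (∀ φ : 𝓓((⊤ : TopologicalSpace.Opens ℝ), ℂ), T φ = ∫ t : ℝ, f t * φ t) ∧
    ∃ ε₀ : ℝ, 0 < ε₀ ∧ ∀ ε : ℝ, 0 < ε → ε < ε₀ →
      LocallyIntegrable (fun t : ℝ => f t * ((|t| ^ (-ε) : ℝ) : ℂ)) volume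

/-- The functional `T` on test functions extends to a continuous linear functional on the space of
compactly supported functions of class `C^n` on `ℝ`. -/
def ExtendsToContDiff (n : ℕ) (T : (ℝ → ℂ) → ℂ) : Prop :=
  ∃ S : 𝓓^{(n : ℕ∞)}((⊤ : TopologicalSpace.Opens ℝ), ℂ) →L[ℂ] ℂ,
    ∀ (φ : 𝓓((⊤ : TopologicalSpace.Opens ℝ), ℂ))
      (ψ : 𝓓^{(n : ℕ∞)}((⊤ : TopologicalSpace.Opens ℝ), ℂ)), (ψ : ℝ → ℂ) = φ → S ψ = T φ

end MellinBarnes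

end

noncomputable section

namespace MellinBarnes

/-! ### The Riesz distributions -/

/-! Fix a test function `φ`. Both integrands are meromorphic in `z` with poles only at integers.
Each integration by parts in `⟨t_+^z, φ⟩` puts another factor `z + j + 1` in the denominator, so the
pairing decays faster than any power of `|Im z|` in vertical strips (`norm_rieszPlus_le`). The Gamma
quotient grows at most polynomially there (`norm_gammaRatio_le`), and `cot πz`, `1 / sin πz` are
bounded for `|Im z| ≥ 1`. Hence all integrals converge absolutely, and a contour may be moved at
will as long as it crosses no pole.

Moving `L` to `L₀` crosses exactly `-1, …, -m` (`contourIntegral_shift`). At `-k` the factor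
`Γ(-z)/Γ(z+1+m) · 2^z` equals `(k-1)! / (2^k (m-k)!)`, and `t_+^z` has residue `(-1)^(k-1) δ^(k-1) /
(k-1)!`; this gives the formula for `Ψ_m^+`. In the other kernel the Riesz distributions and the
trigonometric factors all have simple poles, but the double pole cancels: up to a term without pole,
the bracket is `(t_+^z + (-1)^k t_-^z) / sin π(z+k)`, so the residue is a multiple of `t^{-k} / π`
(`tendsto_mul_kernel`).

The residue theorem is made elementary by subtracting multiples of `1/(z+k) - 1/z`, whose contour
integrals are read off from explicit logarithms. What is left is holomorphic on a plane with two
real half-lines removed and has a primitive there, so Cauchy's theorem reduces to the increments of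
that primitive near `±i∞`.

For local integrability, `L₀` is replaced by `rootContour`, which crosses at `-1/2`, stays in `|Re
z| ≤ 1/2`, and is the line `Re z = 1/2` for `|Im z| ≥ 1`. On that line the Gamma quotient alone is
`O(|Im z|⁻²)`, so the integral converges for each `t > 0` without a test function. Fubini identifies
the distribution with a function bounded by a multiple of `|t|^{-1/2} + |t|^{1/2}`.

The extension statements follow by counting derivatives: `δ^(k-1)` uses `k - 1` of them, and
`t^{-k}` uses `k`, being `log |t|` integrated against `φ^(k)`. -/

/-- The analytic continuation of `⟨x_+^z, φ⟩` after `n` integrations by parts. -/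
def rieszAux (n : ℕ) (z : ℂ) (φ : ℝ → ℂ) : ℂ :=
  ((-1 : ℂ) ^ n / ∏ j ∈ Finset.range n, (z + (j : ℂ) + 1)) *
    mellin (iteratedDeriv n φ) (z + n + 1)

/-- Smooth functions with compact support. -/
structure IsTest (φ : ℝ → ℂ) : Prop where
  contDiff : ContDiff ℝ (⊤ : ℕ∞) φ
  hasCompactSupport : HasCompactSupport φ

theorem isTest_testFunction (φ : 𝓓((⊤ : TopologicalSpace.Opens ℝ), ℂ)) : IsTest φ :=
  ⟨φ.contDiff, φ.hasCompactSupport⟩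

theorem hasCompactSupport_iteratedDeriv {φ : ℝ → ℂ} (h : HasCompactSupport φ) (n : ℕ) :
    HasCompactSupport (iteratedDeriv n φ) := by
  induction n with
  | zero => simpa using h
  | succ n ih => rw [iteratedDeriv_succ]; exact ih.deriv

theorem IsTest.continuous {φ : ℝ → ℂ} (h : IsTest φ) : Continuous φ := h.contDiff.continuous

theorem IsTest.iteratedDeriv {φ : ℝ → ℂ} (h : IsTest φ) (n : ℕ) : IsTest (iteratedDeriv n φ) := by
  refine ⟨?_, hasCompactSupport_iteratedDeriv h.hasCompactSupport n⟩
  have h1 := h.contDiff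
  rw [contDiff_infty] at h1 ⊢
  intro k
  rw [iteratedDeriv_eq_iterate]
  exact ContDiff.iterate_deriv' k n (h1 (k + n))

theorem IsTest.comp_neg {φ : ℝ → ℂ} (h : IsTest φ) : IsTest (fun x => φ (-x)) :=
  ⟨h.contDiff.comp contDiff_neg,
    h.hasCompactSupport.comp_homeomorph (Homeomorph.neg ℝ)⟩

theorem mellin_eq_setIntegral (ψ : ℝ → ℂ) (w : ℂ) :
    mellin ψ (w + 1) = ∫ x in Set.Ioi (0 : ℝ), (x : ℂ) ^ w * ψ x := by
  simp [mellin]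

theorem rieszPlus_eq_rieszAux_floor (z : ℂ) (φ : ℝ → ℂ) :
    rieszPlus z φ = rieszAux ⌊-z.re⌋₊ z φ := by
  rw [rieszPlus, rieszAux, mellin_eq_setIntegral]

/-- The Mellin transform of a compactly supported continuous function on `[0, ∞)`. -/
theorem mellin_hasDerivAt_of_hasCompactSupport {ψ : ℝ → ℂ} (hc : Continuous ψ)
    (hs : HasCompactSupport ψ) {s : ℂ} (h : 0 < s.re) :
    MellinConvergent ψ s ∧ HasDerivAt (mellin ψ) (mellin (fun t => Real.log t • ψ t) s) s := by
  have h1 : LocallyIntegrableOn ψ (Set.Ioi 0) := hc.locallyIntegrable.locallyIntegrableOn _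
  have h2 : ψ =O[atTop] (fun x : ℝ => x ^ (-(s.re + 1))) := by
    have : ψ =ᶠ[atTop] (fun _ => (0 : ℂ)) :=
      (hasCompactSupport_iff_eventuallyEq.1 hs).filter_mono
        (by rw [coclosedCompact_eq_cocompact]; exact atTop_le_cocompact)
    exact this.trans_isBigO (Asymptotics.isBigO_zero _ _)
  have h3 : ψ =O[𝓝[>] 0] (fun x : ℝ => x ^ (-(0 : ℝ))) := by
    simp only [neg_zero, Real.rpow_zero]
    exact (hc.tendsto 0).isBigO_one ℝ |>.mono nhdsWithin_le_nhds
  exact ⟨mellinConvergent_of_isBigO_rpow h1 h2 (by linarith) h3 h,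
    (mellin_hasDerivAt_of_isBigO_rpow h1 h2 (by linarith) h3 h).2⟩

/-- One integration by parts. -/
theorem mellin_eq_neg_mellin_deriv {ψ : ℝ → ℂ} (hψ : ContDiff ℝ 1 ψ) (hs : HasCompactSupport ψ)
    {s : ℂ} (h : 0 < s.re) : mellin ψ s = -(1 / s) * mellin (deriv ψ) (s + 1) := by
  have hs0 : s ≠ 0 := by rintro rfl; simp at h
  have hc' : Continuous (deriv ψ) := hψ.continuous_deriv le_rfl
  have c1 := (mellin_hasDerivAt_of_hasCompactSupport hψ.continuous hs h).1
  have c2 := (mellin_hasDerivAt_of_hasCompactSupport hc' hs.deriv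
    (s := s + 1) (by simp; linarith)).1
  have h1 := integral_Ioi_mul_deriv_eq_deriv_mul (a := 0) (u := ψ) (u' := deriv ψ)
    (v := fun x : ℝ => (x : ℂ) ^ s / s) (v' := fun x : ℝ => (x : ℂ) ^ (s - 1)) (a' := 0) (b' := 0)
    (fun x _ => (hψ.differentiable one_ne_zero x).hasDerivAt)
    (fun x hx => by
      have := hasDerivAt_ofReal_cpow_const' (x := x) (ne_of_gt hx) (r := s - 1)
        (by intro h; apply hs0; linear_combination h)
      simpa using this)
    (by
      refine c1.congr_fun (fun x _ => ?_) measurableSet_Ioi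
      simp [mul_comm])
    (by
      refine (c2.div_const s).congr_fun (fun x _ => ?_) measurableSet_Ioi
      simp; ring)
    (by
      have h2 : ContinuousAt (fun x : ℝ => ψ x * ((x : ℂ) ^ s / s)) 0 :=
        hψ.continuous.continuousAt.mul
          ((Complex.continuousAt_ofReal_cpow_const _ _ (Or.inl h)).div_const s)
      have h3 := h2.tendsto.mono_left (nhdsWithin_le_nhds (s := Set.Ioi 0))
      simp only [Complex.ofReal_zero, Complex.zero_cpow hs0, zero_div, mul_zero] at h3
      exact h3)
    (by
      have : (fun x : ℝ => (0 : ℂ)) =ᶠ[atTop] (ψ * fun x : ℝ => (x : ℂ) ^ s / s) := by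
        filter_upwards [(hasCompactSupport_iff_eventuallyEq.1 hs).filter_mono
          (by rw [coclosedCompact_eq_cocompact]; exact atTop_le_cocompact)] with x hx
        simp [hx]
      exact tendsto_const_nhds.congr' this)
  have e1 : mellin ψ s = ∫ x in Set.Ioi (0 : ℝ), ψ x * (x : ℂ) ^ (s - 1) := by
    rw [mellin]; simp only [smul_eq_mul, mul_comm]
  have e2 : mellin (deriv ψ) (s + 1) = s * ∫ x in Set.Ioi (0 : ℝ), deriv ψ x * ((x : ℂ) ^ s / s) := by
    rw [mellin_eq_setIntegral, ← integral_const_mul]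
    congr 1; ext x; field_simp
  rw [e1, h1, e2]
  field_simp
  simp

/-- The factor `-1 / (z + n + 1)` produced by one integration by parts is exactly the change of the
prefactor from `n` to `n + 1`. -/
theorem rieszAux_succ {φ : ℝ → ℂ} (hφ : IsTest φ) {n : ℕ} {z : ℂ} (h : -1 < z.re + n) :
    rieszAux (n + 1) z φ = rieszAux n z φ := by
  have h0 : 0 < (z + n + 1).re := by simp; linarith
  have h1 : z + n + 1 ≠ 0 := by intro h; rw [h] at h0; simp at h0
  rw [rieszAux, rieszAux, mellin_eq_neg_mellin_deriv ((hφ.iteratedDeriv n).contDiff.of_le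
    (by norm_cast))
    (hφ.iteratedDeriv n).hasCompactSupport h0, ← iteratedDeriv_succ, Finset.prod_range_succ]
  push_cast
  rw [show z + (n + 1) + 1 = z + n + 1 + 1 by ring, pow_succ]
  rw [div_mul_eq_div_div, div_eq_mul_one_div (_ / _) (z + n + 1)]
  ring

theorem rieszAux_eq_of_le {φ : ℝ → ℂ} (hφ : IsTest φ) {n k : ℕ} (hnk : n ≤ k) {z : ℂ}
    (h : -1 < z.re + n) : rieszAux k z φ = rieszAux n z φ := by
  induction k, hnk using Nat.le_induction with
  | base => rfl
  | succ k hk ih =>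
    rw [rieszAux_succ hφ, ih]
    have : (n : ℝ) ≤ k := by exact_mod_cast hk
    linarith

/-- The floor in `rieszPlus` jumps with `z`. Any sufficiently large number of integrations by parts
gives the same value, so `n` can be held fixed near a point or throughout a strip, as holomorphy and
uniform bounds require. -/
theorem rieszPlus_eq_rieszAux {φ : ℝ → ℂ} (hφ : IsTest φ) {n : ℕ} {z : ℂ} (h : -1 < z.re + n) :
    rieszPlus z φ = rieszAux n z φ := by
  have h1 : ⌊-z.re⌋₊ ≤ n := by
    rcases le_or_gt 0 (-z.re) with h0 | h0
    · have := Nat.floor_le h0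
      have h2 : ((⌊-z.re⌋₊ : ℕ) : ℝ) < n + 1 := by linarith
      exact Nat.lt_succ_iff.1 (by exact_mod_cast h2)
    · rw [Nat.floor_of_nonpos h0.le]; exact Nat.zero_le _
  rw [rieszPlus_eq_rieszAux_floor]
  refine (rieszAux_eq_of_le hφ h1 ?_).symm
  linarith [Nat.lt_floor_add_one (-z.re)]

theorem differentiableAt_mellin_shift {ψ : ℝ → ℂ} (hψ : IsTest ψ) {n : ℕ} {z : ℂ}
    (h : -1 < z.re + n) :
    DifferentiableAt ℂ (fun z => mellin ψ (z + n + 1)) z := by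
  have h0 : 0 < (z + n + 1).re := by simp; linarith
  have := (mellin_hasDerivAt_of_hasCompactSupport hψ.continuous hψ.hasCompactSupport h0).2
  exact DifferentiableAt.comp (g := mellin ψ) (f := fun z : ℂ => z + n + 1) z
    this.differentiableAt (by fun_prop)

theorem eventually_rieszPlus_eq {φ : ℝ → ℂ} (hφ : IsTest φ) {n : ℕ} {z : ℂ} (h : -1 < z.re + n) :
    (fun w => rieszPlus w φ) =ᶠ[𝓝 z] fun w => rieszAux n w φ := by
  have h1 : ∀ᶠ w : ℂ in 𝓝 z, -1 < w.re + n :=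
    (Complex.continuous_re.add continuous_const).continuousAt.eventually (lt_mem_nhds h)
  filter_upwards [h1] with w hw using rieszPlus_eq_rieszAux hφ hw

theorem differentiableAt_rieszPlus {φ : ℝ → ℂ} (hφ : IsTest φ) {z : ℂ}
    (h : ∀ j : ℕ, z + j + 1 ≠ 0) : DifferentiableAt ℂ (fun z => rieszPlus z φ) z := by
  have hn : -1 < z.re + (⌊-z.re⌋₊ : ℕ) := by linarith [Nat.lt_floor_add_one (-z.re)]
  refine DifferentiableAt.congr_of_eventuallyEq ?_ (eventually_rieszPlus_eq hφ hn)
  refine DifferentiableAt.mul (DifferentiableAt.div (by fun_prop) ?_ ?_)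
    (differentiableAt_mellin_shift (hφ.iteratedDeriv _) hn)
  · fun_prop
  · exact Finset.prod_ne_zero_iff.2 fun j _ => h j

/-- On the strip, `|x^(s-1)| ≤ (1 + x)^K` for `x > 0`, a majorant independent of `s`. -/
theorem norm_mellin_le {ψ : ℝ → ℂ} (hψ : IsTest ψ) (K : ℕ) :
    ∃ C : ℝ, 0 ≤ C ∧ ∀ s : ℂ, 1 ≤ s.re → s.re ≤ K + 1 → ‖mellin ψ s‖ ≤ C := by
  refine ⟨∫ x in Set.Ioi (0 : ℝ), (1 + |x|) ^ K * ‖ψ x‖, by positivity, fun s h1 h2 => ?_⟩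
  rw [mellin]
  refine norm_integral_le_of_norm_le ?_ ?_
  · refine Integrable.integrableOn ?_
    refine Continuous.integrable_of_hasCompactSupport ?_ ?_
    · have := hψ.continuous
      fun_prop
    · exact hψ.hasCompactSupport.norm.mul_left
  · refine (ae_restrict_iff' measurableSet_Ioi).2 (Eventually.of_forall fun x hx => ?_)
    rw [norm_smul, Complex.norm_cpow_eq_rpow_re_of_pos hx]
    gcongr
    rw [abs_of_pos hx]
    have hx0 : (0 : ℝ) < x := hx
    calc x ^ (s - 1).re ≤ (1 + x) ^ (s - 1).re :=
          Real.rpow_le_rpow hx0.le (by linarith) (by simpa using h1)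
      _ ≤ (1 + x) ^ (K : ℝ) :=
          Real.rpow_le_rpow_of_exponent_le (by linarith) (by simp; linarith)
      _ = _ := Real.rpow_natCast _ _

theorem abs_im_le_norm_add (z : ℂ) (a : ℝ) : |z.im| ≤ ‖z + a‖ := by
  simpa using Complex.abs_im_le_norm (z + a)

/-- Rapid decay of `⟨x_+^z, φ⟩` in vertical strips. -/
theorem norm_rieszPlus_le {φ : ℝ → ℂ} (hφ : IsTest φ) (R N : ℕ) :
    ∃ C : ℝ, 0 ≤ C ∧ ∀ z : ℂ, |z.re| ≤ R → 1 ≤ |z.im| → ‖rieszPlus z φ‖ ≤ C / |z.im| ^ N := by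
  obtain ⟨C, hC, h⟩ := norm_mellin_le (hφ.iteratedDeriv (R + N)) (2 * R + N)
  refine ⟨C, hC, fun z h1 h2 => ?_⟩
  have h1' := abs_le.1 h1
  have hN : (0 : ℝ) ≤ N := N.cast_nonneg
  have hp : 0 < |z.im| := by linarith
  -- `R` integrations by parts bring the Mellin argument to real part at least `1`; the other `N`
  -- supply the decay. Each of the `R + N` factors of the denominator has modulus at least `|Im z| ≥
  -- 1`.
  rw [rieszPlus_eq_rieszAux hφ (n := R + N) (by push_cast; linarith), rieszAux]
  have h3 : |z.im| ^ (R + N) ≤ ‖∏ j ∈ Finset.range (R + N), (z + (j : ℂ) + 1)‖ := by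
    rw [norm_prod]
    calc |z.im| ^ (R + N) = ∏ j ∈ Finset.range (R + N), |z.im| := by simp
      _ ≤ _ := Finset.prod_le_prod (fun _ _ => abs_nonneg _) fun j _ => by
        have := abs_im_le_norm_add z (j + 1)
        push_cast at this
        rwa [← add_assoc] at this
  have h4 : |z.im| ^ N ≤ |z.im| ^ (R + N) := pow_le_pow_right₀ h2 (by omega)
  have h5 := h (z + ((R + N : ℕ) : ℂ) + 1) (by simp; linarith) (by simp; linarith)
  rw [norm_mul, norm_div, norm_pow, norm_neg, norm_one, one_pow, div_mul_eq_mul_div, one_mul]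
  gcongr
  exact h4.trans h3

/-! ### Bounds for the quotient of Gamma functions -/

theorem add_ofReal_ne_zero_of_im_ne_zero {z : ℂ} (hz : z.im ≠ 0) (a : ℝ) : z + a ≠ 0 := by
  intro h
  apply hz
  simpa using congrArg Complex.im h

theorem Gamma_add_nat_eq_mul_prod {u : ℂ} (hu : u.im ≠ 0) (n : ℕ) :
    Complex.Gamma (u + n) = Complex.Gamma u * ∏ j ∈ Finset.range n, (u + j) := by
  induction n with
  | zero => simp
  | succ n ih =>
    have h := Complex.Gamma_add_one (u + n)
      (by simpa using add_ofReal_ne_zero_of_im_ne_zero hu (n : ℝ))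
    rw [Finset.prod_range_succ, ← mul_assoc, ← ih]
    push_cast
    rw [← add_assoc, h, mul_comm]

theorem Gamma_ne_zero_of_im_ne_zero {z : ℂ} (hz : z.im ≠ 0) : Complex.Gamma z ≠ 0 := by
  refine Complex.Gamma_ne_zero fun m h => hz ?_
  rw [h]; simp

theorem pow_abs_im_le_norm_prod (u : ℂ) (n : ℕ) :
    |u.im| ^ n ≤ ‖∏ j ∈ Finset.range n, (u + j)‖ := by
  rw [norm_prod]
  calc |u.im| ^ n = ∏ j ∈ Finset.range n, |u.im| := by simp
    _ ≤ _ := Finset.prod_le_prod (fun _ _ => abs_nonneg _) fun j _ => by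
      simpa using abs_im_le_norm_add u j

theorem norm_betaIntegral_le_one {u v : ℂ} (hu : 1 ≤ u.re) (hv : 1 ≤ v.re) :
    ‖Complex.betaIntegral u v‖ ≤ 1 := by
  rw [Complex.betaIntegral]
  have := intervalIntegral.norm_integral_le_of_norm_le_const (a := 0) (b := 1) (C := 1)
    (f := fun x : ℝ => (x : ℂ) ^ (u - 1) * (1 - (x : ℂ)) ^ (v - 1)) (fun x hx => ?_)
  · simpa using this
  · rw [Set.uIoc_of_le zero_le_one] at hx
    -- At the endpoint `x = 1` the second factor is `0 ^ (v - 1)`, which is `1` if `v = 1` and `0`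
    -- otherwise.
    rcases hx.2.eq_or_lt with rfl | h1
    · rw [norm_mul]
      have h3 : ‖(1 - ((1 : ℝ) : ℂ)) ^ (v - 1)‖ ≤ 1 := by
        by_cases hv' : v = 1
        · simp [hv']
        · rw [Complex.ofReal_one, sub_self, Complex.zero_cpow (sub_ne_zero.2 hv')]
          simp
      simpa using h3
    · rw [norm_mul, Complex.norm_cpow_eq_rpow_re_of_pos hx.1,
        show (1 - (x : ℂ)) = ((1 - x : ℝ) : ℂ) by push_cast; rfl,
        Complex.norm_cpow_eq_rpow_re_of_pos (by linarith)]
      have a1 := Real.rpow_le_one hx.1.le hx.2 (z := (u - 1).re) (by simpa using hu)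
      have a2 := Real.rpow_le_one (x := 1 - x) (by linarith) (by linarith [hx.1])
        (z := (v - 1).re) (by simpa using hv)
      exact mul_le_one₀ a1 (by apply Real.rpow_nonneg; linarith) a2

/-- From `Γ(u) Γ(v) = Γ(u + v) B(u, v)` with `|B(u, v)| ≤ 1` and `Γ(v) ≥ Γ(2) = 1`. This
monotonicity under real shifts plays the role of Stirling's formula. -/
theorem norm_Gamma_le_norm_Gamma_add {u : ℂ} {v : ℝ} (hu : 1 ≤ u.re) (hv : 2 ≤ v) :
    ‖Complex.Gamma u‖ ≤ ‖Complex.Gamma (u + v)‖ := by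
  have h := congrArg norm (Complex.Gamma_mul_Gamma_eq_betaIntegral (s := u) (t := v)
    (by linarith) (by simp; linarith))
  rw [norm_mul, norm_mul, Complex.Gamma_ofReal, Complex.norm_real] at h
  have h1 : 1 ≤ ‖Real.Gamma v‖ := by
    have := Real.Gamma_strictMonoOn_Ici.monotoneOn (a := 2) (b := v) (by simp) hv hv
    rw [Real.Gamma_two] at this
    exact this.trans (le_abs_self _)
  have h2 := norm_betaIntegral_le_one (u := u) (v := v) hu (by simp; linarith)
  nlinarith [norm_nonneg (Complex.Gamma u), norm_nonneg (Complex.Gamma (u + v))]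

/-- Conjugating the numerator's argument gives both arguments the same imaginary part, so they
differ by a real shift. -/
theorem norm_gammaRatio_eq (m : ℕ) (z : ℂ) :
    ‖gammaRatio m z‖ = ‖Complex.Gamma ((starRingEnd ℂ) (-z))‖ / ‖Complex.Gamma (z + 1 + m)‖ := by
  rw [gammaRatio, norm_div, Complex.Gamma_conj, Complex.norm_conj]

/-- Polynomial growth in vertical strips. -/
theorem norm_gammaRatio_le (m R : ℕ) : ∃ (C : ℝ) (A : ℕ), 0 ≤ C ∧
    ∀ z : ℂ, |z.re| ≤ R → 1 ≤ |z.im| → ‖gammaRatio m z‖ ≤ C * |z.im| ^ A := by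
  -- Chosen so that the real shift `v` used below is at least `m + 2` when `Re z ≥ -R`.
  set N := 3 * R + 2 with hN
  refine ⟨((R : ℝ) + m + N + 2) ^ N, N, by positivity, fun z h1 h2 => ?_⟩
  have h1' := abs_le.1 h1
  have hz0 : z.im ≠ 0 := by rintro h; simp [h] at h2; linarith
  have hm : (0 : ℝ) ≤ m := m.cast_nonneg
  have hR : (0 : ℝ) ≤ R := R.cast_nonneg
  set u := (starRingEnd ℂ) (-z) with hu
  set w := z + 1 + m with hw
  have hure : u.re = -z.re := by simp [hu]
  have huim : u.im = z.im := by simp [hu]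
  have hwim : w.im = z.im := by simp [hw]
  have hpu := pow_abs_im_le_norm_prod u (R + 1)
  have e1 := congrArg norm (Gamma_add_nat_eq_mul_prod (u := u) (by rwa [huim]) (R + 1))
  have e2 := congrArg norm (Gamma_add_nat_eq_mul_prod (u := w) (by rwa [hwim]) N)
  -- Raising `u` by `R + 1` makes its real part at least `1`; `v` is then the real distance from `u
  -- + R + 1` to `w + N`. The two products that convert back to `Γ(u)` and `Γ(w)` cost only a power
  -- of `|Im z|`.
  have e3 := norm_Gamma_le_norm_Gamma_add (u := u + (R + 1 : ℕ)) (v := 1 + m + 2 * z.re + N - (R + 1))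
    (by simp [hure]; linarith) (by simp [hN]; linarith)
  have e4 : u + (R + 1 : ℕ) + ((1 + m + 2 * z.re + N - (R + 1) : ℝ) : ℂ) = w + N := by
    apply Complex.ext
    · simp [hu, hw]; ring
    · simp [hu, hw]
  rw [e4, e1, e2, norm_mul, norm_mul] at e3
  have h5 : ‖∏ j ∈ Finset.range N, (w + j)‖ ≤ (((R : ℝ) + m + N + 2) * |z.im|) ^ N := by
    rw [norm_prod]
    calc _ ≤ ∏ j ∈ Finset.range N, (((R : ℝ) + m + N + 2) * |z.im|) := by
          refine Finset.prod_le_prod (fun _ _ => norm_nonneg _) fun j hj => ?_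
          have hj' : (j : ℝ) ≤ N := by exact_mod_cast (Finset.mem_range.1 hj).le
          have hj0 : (0 : ℝ) ≤ j := j.cast_nonneg
          have := Complex.norm_le_abs_re_add_abs_im (w + j)
          have h6 : |(w + j).re| ≤ R + 1 + m + N := by
            simp only [hw, Complex.add_re, Complex.natCast_re, Complex.one_re]
            rw [abs_le]; constructor <;> linarith
          have h7 : |(w + j).im| = |z.im| := by simp [hw]
          rw [h7] at this
          nlinarith
      _ = _ := by simp
  have h8 : 1 ≤ |u.im| ^ (R + 1) := by rw [huim]; exact one_le_pow₀ h2
  have hG : 0 < ‖Complex.Gamma w‖ := norm_pos_iff.2 (Gamma_ne_zero_of_im_ne_zero (by rwa [hwim]))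
  rw [norm_gammaRatio_eq, ← mul_pow, div_le_iff₀ hG]
  calc ‖Complex.Gamma u‖ ≤ ‖Complex.Gamma u‖ * ‖∏ j ∈ Finset.range (R + 1), (u + j)‖ :=
        le_mul_of_one_le_right (norm_nonneg _) (h8.trans hpu)
    _ ≤ _ := e3
    _ ≤ _ := by rw [mul_comm]; gcongr

/-- On the line `Re z = 1/2` the quotient decays quadratically. -/
theorem norm_gammaRatio_le_inv_sq (m : ℕ) {z : ℂ} (hre : z.re = 1 / 2) (h2 : 1 ≤ |z.im|) :
    ‖gammaRatio m z‖ ≤ (|z.im| ^ 2)⁻¹ := by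
  have hz0 : z.im ≠ 0 := by rintro h; simp [h] at h2; linarith
  set u := (starRingEnd ℂ) (-z) with hu
  have hure : u.re = -z.re := by simp [hu]
  have huim : u.im = z.im := by simp [hu]
  have hu0 : u.im ≠ 0 := by rwa [huim]
  -- On `Re z = 1/2` the real shift is the integer `m + 2`, so the quotient of moduli is exactly one
  -- over a product of `m + 2` linear factors.
  have e4 : z + 1 + m = u + (m + 2 : ℕ) := by
    apply Complex.ext
    · simp [hu]; linarith
    · simp [hu]
  have hpu := pow_abs_im_le_norm_prod u (m + 2)
  rw [huim] at hpu
  have h5 : |z.im| ^ 2 ≤ |z.im| ^ (m + 2) := pow_le_pow_right₀ h2 (by omega)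
  rw [norm_gammaRatio_eq, e4, Gamma_add_nat_eq_mul_prod hu0, norm_mul, div_mul_cancel_left₀
    (norm_ne_zero_iff.2 (Gamma_ne_zero_of_im_ne_zero hu0))]
  exact inv_anti₀ (by positivity) (h5.trans hpu)

/-! ### Contour integrals -/

/-- The plane without the real half-lines `(-∞, a]` and `[b, ∞)`. -/
def slitDomain (a b : ℝ) : Set ℂ := {z | z.im ≠ 0 ∨ (a < z.re ∧ z.re < b)}

theorem isOpen_slitDomain (a b : ℝ) : IsOpen (slitDomain a b) := by
  refine IsOpen.union ?_ (IsOpen.inter ?_ ?_)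
  · exact isOpen_ne_fun Complex.continuous_im continuous_const
  · exact isOpen_lt continuous_const Complex.continuous_re
  · exact isOpen_lt Complex.continuous_re continuous_const

theorem exists_primitive_of_convex {F : ℂ → ℂ} {U : Set ℂ} (hU : Convex ℝ U) (hUo : IsOpen U)
    (hF : DifferentiableOn ℂ F U) (w c : ℂ) :
    ∃ G : ℂ → ℂ, G w = c ∧ ∀ z ∈ U, HasDerivAt G (F z) z := by
  obtain ⟨G, hG⟩ := hU.exists_forall_hasDerivWithinAt hF
  refine ⟨fun z => G z - G w + c, by simp, fun z hz => ?_⟩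
  exact (((hG z hz).hasDerivAt (hUo.mem_nhds hz)).sub_const _).add_const _

theorem eqOn_of_hasDerivAt_of_convex {F G₁ G₂ : ℂ → ℂ} {U : Set ℂ} (hU : Convex ℝ U)
    (hUo : IsOpen U) (h₁ : ∀ z ∈ U, HasDerivAt G₁ (F z) z) (h₂ : ∀ z ∈ U, HasDerivAt G₂ (F z) z)
    {w : ℂ} (hw : w ∈ U) (h : G₁ w = G₂ w) : Set.EqOn G₁ G₂ U :=
  hUo.eqOn_of_deriv_eq hU.isPreconnected
    (fun z hz => (h₁ z hz).differentiableAt.differentiableWithinAt)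
    (fun z hz => (h₂ z hz).differentiableAt.differentiableWithinAt)
    (fun z hz => by rw [(h₁ z hz).deriv, (h₂ z hz).deriv]) hw h

/-- The domain is the union of a vertical strip and the two open half-planes, all convex. Primitives
on the half-planes, normalised at `c ± i`, agree with the strip's primitive on the convex overlaps,
and the half-planes are disjoint, so the three glue. -/
theorem exists_primitive_slitDomain {a b : ℝ} (hab : a < b) {F : ℂ → ℂ}
    (hF : DifferentiableOn ℂ F (slitDomain a b)) :
    ∃ G : ℂ → ℂ, ∀ z ∈ slitDomain a b, HasDerivAt G (F z) z := by
  obtain ⟨c, hac, hcb⟩ := exists_between hab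
  set S : Set ℂ := {z | a < z.re ∧ z.re < b} with hS
  have hSo : IsOpen S := (isOpen_lt continuous_const Complex.continuous_re).inter
    (isOpen_lt Complex.continuous_re continuous_const)
  have hSc : Convex ℝ S := (convex_halfSpace_re_gt a).inter (convex_halfSpace_re_lt b)
  set U : Set ℂ := {z | 0 < z.im} with hU
  set V : Set ℂ := {z | z.im < 0} with hV
  have hUo : IsOpen U := isOpen_lt continuous_const Complex.continuous_im
  have hVo : IsOpen V := isOpen_lt Complex.continuous_im continuous_const
  have hUc : Convex ℝ U := convex_halfSpace_im_gt 0
  have hVc : Convex ℝ V := convex_halfSpace_im_lt 0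
  set p : ℂ := c + Complex.I with hp
  set q : ℂ := c - Complex.I with hq
  obtain ⟨G, -, hG⟩ := exists_primitive_of_convex hSc hSo (hF.mono fun z hz => Or.inr hz) 0 0
  obtain ⟨Gu, hup, hu⟩ := exists_primitive_of_convex hUc hUo
    (hF.mono fun z hz => Or.inl (ne_of_gt hz)) p (G p)
  obtain ⟨Gl, hlq, hl⟩ := exists_primitive_of_convex hVc hVo
    (hF.mono fun z hz => Or.inl (ne_of_lt hz)) q (G q)
  have hSU := eqOn_of_hasDerivAt_of_convex (hSc.inter hUc) (hSo.inter hUo)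
    (fun z hz => hu z hz.2) (fun z hz => hG z hz.1) (w := p)
    (by simp [hS, hU, hp, hac, hcb]) hup
  have hSV := eqOn_of_hasDerivAt_of_convex (hSc.inter hVc) (hSo.inter hVo)
    (fun z hz => hl z hz.2) (fun z hz => hG z hz.1) (w := q)
    (by simp [hS, hV, hq, hac, hcb]) hlq
  refine ⟨fun z => if 0 < z.im then Gu z else if z.im < 0 then Gl z else G z, fun z hz => ?_⟩
  rcases lt_trichotomy z.im 0 with h | h | h
  · refine (hl z h).congr_of_eventuallyEq ?_
    filter_upwards [hVo.mem_nhds h] with w hw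
    rw [if_neg (not_lt.2 (le_of_lt hw)), if_pos (show w.im < 0 from hw)]
  · have hzS : z ∈ S := hz.resolve_left (not_not.2 h)
    refine (hG z hzS).congr_of_eventuallyEq ?_
    filter_upwards [hSo.mem_nhds hzS] with w hw
    split_ifs with h1 h2
    · exact hSU ⟨hw, h1⟩
    · exact hSV ⟨hw, h2⟩
    · rfl
  · refine (hu z h).congr_of_eventuallyEq ?_
    filter_upwards [hUo.mem_nhds h] with w hw
    rw [if_pos (show 0 < w.im from hw)]

/-- Decay like `|Im z|⁻²` in vertical strips. -/
def HasStripDecay (F : ℂ → ℂ) : Prop :=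
  ∀ R : ℕ, ∃ C : ℝ, 0 ≤ C ∧ ∀ z : ℂ, |z.re| ≤ R → 1 ≤ |z.im| → ‖F z‖ ≤ C / |z.im| ^ 2

theorem HasStripDecay.add {F G : ℂ → ℂ} (hF : HasStripDecay F) (hG : HasStripDecay G) :
    HasStripDecay (fun z => F z + G z) := by
  intro R
  obtain ⟨C, hC, h⟩ := hF R
  obtain ⟨D, hD, h'⟩ := hG R
  refine ⟨C + D, by positivity, fun z h1 h2 => ?_⟩
  rw [add_div]
  exact (norm_add_le _ _).trans (add_le_add (h z h1 h2) (h' z h1 h2))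

theorem HasStripDecay.const_mul {F : ℂ → ℂ} (hF : HasStripDecay F) (c : ℂ) :
    HasStripDecay (fun z => c * F z) := by
  intro R
  obtain ⟨C, hC, h⟩ := hF R
  refine ⟨‖c‖ * C, by positivity, fun z h1 h2 => ?_⟩
  rw [norm_mul, mul_div_assoc]
  exact mul_le_mul_of_nonneg_left (h z h1 h2) (norm_nonneg _)

theorem HasStripDecay.sum {ι : Type*} (s : Finset ι) {F : ι → ℂ → ℂ}
    (hF : ∀ i ∈ s, HasStripDecay (F i)) : HasStripDecay (fun z => ∑ i ∈ s, F i z) := by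
  classical
  induction s using Finset.induction_on with
  | empty => exact fun R => ⟨0, le_rfl, fun z _ _ => by simp⟩
  | insert i s hi ih =>
    simp only [Finset.sum_insert hi]
    exact (hF i (Finset.mem_insert_self _ _)).add
      (ih fun j hj => hF j (Finset.mem_insert_of_mem hj))

theorem exists_bound_of_eventually_cocompact {g : ℝ → ℝ} (hg : Continuous g) {K : ℝ}
    (h : ∀ᶠ τ in cocompact ℝ, |g τ| ≤ K) : ∃ K', ∀ τ, |g τ| ≤ K' := by
  obtain ⟨S, hS, hSK⟩ := mem_cocompact.1 h
  obtain ⟨B, hB⟩ := hS.exists_bound_of_continuousOn hg.continuousOn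
  refine ⟨max B K, fun τ => ?_⟩
  by_cases hτ : τ ∈ S
  · exact (hB τ hτ).trans (le_max_left _ _)
  · exact (show |g τ| ≤ K from hSK hτ).trans (le_max_right _ _)

theorem eventually_cocompact_le_abs (M : ℝ) : ∀ᶠ τ : ℝ in cocompact ℝ, M ≤ |τ| :=
  (tendsto_norm_cocompact_atTop (E := ℝ)).eventually_ge_atTop M

namespace IsContour

variable {γ s : ℝ} {L : ℝ → ℂ}

theorem im_ne_zero (hL : IsContour γ s L) {τ : ℝ} (h : τ ≠ 0) : (L τ).im ≠ 0 := by
  rcases h.lt_or_gt with h | h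
  · exact (hL.im_neg τ h).ne
  · exact (hL.im_pos τ h).ne'

theorem mem_slitDomain (hL : IsContour γ s L) {a b : ℝ} (ha : a < s) (hb : s < b) (τ : ℝ) :
    L τ ∈ slitDomain a b := by
  by_cases h : τ = 0
  · rw [h, hL.zero]; exact Or.inr ⟨by simpa, by simpa⟩
  · exact Or.inl (hL.im_ne_zero h)

theorem exists_re_bound (hL : IsContour γ s L) : ∃ R : ℕ, ∀ τ, |(L τ).re| ≤ R := by
  have h : ∀ᶠ τ in cocompact ℝ, |(L τ).re| ≤ |γ| + 1 :=
    hL.tendsto_re.abs.eventually_le_const (by linarith)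
  obtain ⟨K, hK⟩ := exists_bound_of_eventually_cocompact
    (Complex.continuous_re.comp hL.continuous) h
  obtain ⟨R, hR⟩ := exists_nat_ge K
  exact ⟨R, fun τ => (hK τ).trans hR⟩

theorem exists_im_growth (hL : IsContour γ s L) :
    ∃ c : ℝ, 0 < c ∧ ∀ᶠ τ in cocompact ℝ, c * |τ| ≤ |(L τ).im| ∧ 1 ≤ |(L τ).im| ∧ 1 ≤ |τ| := by
  obtain ⟨c, hc, h⟩ := hL.im_growth
  refine ⟨c, hc, ?_⟩
  filter_upwards [h, eventually_cocompact_le_abs c⁻¹, eventually_cocompact_le_abs 1]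
    with τ h1 h2 h3
  refine ⟨h1, le_trans ?_ h1, h3⟩
  rwa [inv_le_iff_one_le_mul₀' hc] at h2

theorem tendsto_norm (hL : IsContour γ s L) :
    Tendsto (fun τ => ‖L τ‖) (cocompact ℝ) atTop := by
  obtain ⟨c, hc, h⟩ := hL.im_growth
  refine tendsto_atTop_mono' _ ?_
    ((tendsto_norm_cocompact_atTop (E := ℝ)).const_mul_atTop hc)
  filter_upwards [h] with τ h1 using h1.trans (Complex.abs_im_le_norm _)

/-- Linear growth of `|Im L|` turns strip decay into a bound by `(1 + τ²)⁻¹`, and the speed is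
bounded. -/
theorem contourIntegrable (hL : IsContour γ s L) {F : ℂ → ℂ}
    (hc : Continuous fun τ => F (L τ)) (hF : HasStripDecay F) : ContourIntegrable L F := by
  obtain ⟨R, hR⟩ := hL.exists_re_bound
  obtain ⟨C, hC, hCF⟩ := hF R
  obtain ⟨c, hc0, hcL⟩ := hL.exists_im_growth
  obtain ⟨B, hB⟩ := hL.bounded_deriv
  have h1 : ∀ᶠ τ in cocompact ℝ, |(1 + τ ^ 2) * ‖F (L τ)‖| ≤ 2 * C / c ^ 2 := by
    filter_upwards [hcL] with τ ⟨h1, h2, h3⟩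
    rw [abs_of_nonneg (by positivity)]
    have h4 := hCF _ (hR τ) h2
    have h5 : (c * |τ|) ^ 2 ≤ |(L τ).im| ^ 2 := by gcongr
    have h6 : 1 + τ ^ 2 ≤ 2 * |τ| ^ 2 := by rw [← sq_abs τ]; nlinarith
    have h7 : 0 < c * |τ| := by positivity
    calc (1 + τ ^ 2) * ‖F (L τ)‖ ≤ (2 * |τ| ^ 2) * (C / (c * |τ|) ^ 2) := by
          gcongr
          exact h4.trans (by gcongr)
      _ = _ := by field_simp
  have hgc : Continuous fun τ : ℝ => (1 + τ ^ 2) * ‖F (L τ)‖ :=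
    (by fun_prop : Continuous fun τ : ℝ => 1 + τ ^ 2).mul hc.norm
  obtain ⟨K, hK⟩ := exists_bound_of_eventually_cocompact hgc h1
  refine (integrable_inv_one_add_sq.const_mul (K * B)).mono' ?_ ?_
  · exact hc.aestronglyMeasurable.mul (measurable_deriv L).aestronglyMeasurable
  · refine Eventually.of_forall fun τ => ?_
    have h2 := hK τ
    rw [abs_of_nonneg (by positivity)] at h2
    have h3 : ‖F (L τ)‖ ≤ K * (1 + τ ^ 2)⁻¹ := by
      rw [← div_eq_mul_inv, le_div_iff₀ (by positivity)]
      linarith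
    have hB0 : 0 ≤ B := (norm_nonneg _).trans (hB 0)
    calc ‖F (L τ) * deriv L τ‖ = ‖F (L τ)‖ * ‖deriv L τ‖ := norm_mul _ _
      _ ≤ (K * (1 + τ ^ 2)⁻¹) * B := by gcongr; exact (norm_nonneg _).trans h3; exact hB τ
      _ = _ := by ring

theorem intervalIntegrable_deriv (hL : IsContour γ s L) (a b : ℝ) :
    IntervalIntegrable (deriv L) volume a b := by
  obtain ⟨B, hB⟩ := hL.bounded_deriv
  exact (intervalIntegrable_const (c := B)).mono_fun'
    (measurable_deriv L).aestronglyMeasurable (Eventually.of_forall fun τ => hB τ)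

theorem integral_eq_sub (hL : IsContour γ s L) {F G : ℂ → ℂ}
    (hc : Continuous fun τ => F (L τ)) (hG : ∀ τ, HasDerivAt G (F (L τ)) (L τ)) (a b : ℝ) :
    ∫ τ in a..b, F (L τ) * deriv L τ = G (L b) - G (L a) := by
  obtain ⟨P, hP, hPL⟩ := hL.piecewise_contDiff
  refine integral_eq_of_hasDerivAt_off_countable (fun τ => G (L τ)) _ hP.countable ?_ ?_ ?_
  · exact fun τ _ => ((hG τ).continuousAt.comp hL.continuous.continuousAt).continuousWithinAt
  · intro τ hτ
    exact (hG τ).comp τ ((hPL τ hτ.2).differentiableAt one_ne_zero).hasDerivAt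
  · exact (hL.intervalIntegrable_deriv a b).continuousOn_mul hc.continuousOn

/-- Bounded speed keeps two contours at most linearly far apart at equal parameters, which quadratic
decay of the integrand beats. -/
theorem exists_norm_le (hL : IsContour γ s L) : ∃ B : ℝ, 0 ≤ B ∧ ∀ τ, ‖L τ - s‖ ≤ B * |τ| := by
  obtain ⟨B, hB⟩ := hL.bounded_deriv
  refine ⟨B, (norm_nonneg _).trans (hB 0), fun τ => ?_⟩
  have h := hL.integral_eq_sub (F := fun _ => 1) (G := id) continuous_const
    (fun τ => hasDerivAt_id _) 0 τ
  rw [hL.zero] at h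
  simp only [one_mul, id] at h
  rw [← h]
  simpa using intervalIntegral.norm_integral_le_of_norm_le_const (a := 0) (b := τ)
    (f := deriv L) (C := B) (fun x _ => hB x)

theorem tendsto_intervalIntegral {F : ℂ → ℂ} (hF : ContourIntegrable L F) :
    Tendsto (fun T : ℝ => ∫ τ in (-T)..T, F (L τ) * deriv L τ) atTop
      (𝓝 (∫ τ, F (L τ) * deriv L τ)) :=
  intervalIntegral_tendsto_integral hF tendsto_neg_atTop_atBot tendsto_id

theorem contourIntegral_eq_of_tendsto (hL : IsContour γ s L) {F G : ℂ → ℂ}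
    (hc : Continuous fun τ => F (L τ)) (hF : HasStripDecay F)
    (hG : ∀ τ, HasDerivAt G (F (L τ)) (L τ)) {A B : ℂ}
    (hA : Tendsto (fun τ => G (L τ)) atTop (𝓝 A)) (hB : Tendsto (fun τ => G (L τ)) atBot (𝓝 B)) :
    contourIntegral L F = 1 / (2 * Real.pi * Complex.I) * (A - B) := by
  rw [contourIntegral]
  congr 1
  refine tendsto_nhds_unique (tendsto_intervalIntegral (hL.contourIntegrable hc hF)) ?_
  simp only [hL.integral_eq_sub hc hG]
  exact hA.sub (hB.comp tendsto_neg_atTop_atBot)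

end IsContour

/-- In a half-strip, the increment of a primitive between points at height `≥ Y` and distance `≤ d`
is `O(d / Y ^ 2)`. -/
theorem norm_primitive_sub_le {F G : ℂ → ℂ} {R : ℕ} {C Y : ℝ} {U : Set ℂ} (hU : Convex ℝ U)
    (hF : ∀ z : ℂ, |z.re| ≤ R → 1 ≤ |z.im| → ‖F z‖ ≤ C / |z.im| ^ 2) (hC : 0 ≤ C) (hY : 1 ≤ Y)
    (hUR : ∀ z ∈ U, |z.re| ≤ R ∧ Y ≤ |z.im|) (hG : ∀ z ∈ U, HasDerivAt G (F z) z)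
    {z w : ℂ} (hz : z ∈ U) (hw : w ∈ U) : ‖G z - G w‖ ≤ C / Y ^ 2 * ‖z - w‖ := by
  refine hU.norm_image_sub_le_of_norm_hasDerivWithin_le (f := G) (f' := F)
    (fun x hx => (hG x hx).hasDerivWithinAt) (fun x hx => ?_) hw hz
  obtain ⟨h1, h2⟩ := hUR x hx
  refine (hF x h1 (hY.trans h2)).trans ?_
  gcongr

theorem convex_halfStrip_upper (R Y : ℝ) : Convex ℝ {z : ℂ | |z.re| ≤ R ∧ Y ≤ z.im} := by
  have : {z : ℂ | |z.re| ≤ R ∧ Y ≤ z.im} = ({z : ℂ | -R ≤ z.re} ∩ {z | z.re ≤ R}) ∩ {z | Y ≤ z.im} := by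
    ext z; simp [abs_le]
  rw [this]
  exact ((convex_halfSpace_re_ge _).inter (convex_halfSpace_re_le _)).inter
    (convex_halfSpace_im_ge _)

theorem convex_halfStrip_lower (R Y : ℝ) : Convex ℝ {z : ℂ | |z.re| ≤ R ∧ z.im ≤ Y} := by
  have : {z : ℂ | |z.re| ≤ R ∧ z.im ≤ Y} = ({z : ℂ | -R ≤ z.re} ∩ {z | z.re ≤ R}) ∩ {z | z.im ≤ Y} := by
    ext z; simp [abs_le]
  rw [this]
  exact ((convex_halfSpace_re_ge _).inter (convex_halfSpace_re_le _)).inter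
    (convex_halfSpace_im_le _)

/-- Cauchy's theorem: contours crossing the real axis in the same gap give the same integral. -/
theorem contourIntegral_eq_of_slitDomain {γ s γ' s' : ℝ} {L L' : ℝ → ℂ} (hL : IsContour γ s L)
    (hL' : IsContour γ' s' L') {a b : ℝ} (ha : a < s) (hb : s < b) (ha' : a < s') (hb' : s' < b)
    {F : ℂ → ℂ} (hF : DifferentiableOn ℂ F (slitDomain a b)) (hd : HasStripDecay F) :
    contourIntegral L F = contourIntegral L' F := by
  obtain ⟨G, hG⟩ := exists_primitive_slitDomain (ha.trans hb) hF
  have hcont : ∀ {γ s : ℝ} {L : ℝ → ℂ}, IsContour γ s L → a < s → s < b →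
      Continuous fun τ => F (L τ) := fun hL h1 h2 =>
    hF.continuousOn.comp_continuous hL.continuous (hL.mem_slitDomain h1 h2)
  have c1 := hcont hL ha hb
  have c2 := hcont hL' ha' hb'
  obtain ⟨R, hR⟩ := hL.exists_re_bound
  obtain ⟨R', hR'⟩ := hL'.exists_re_bound
  obtain ⟨C, hC, hCF⟩ := hd (max R R')
  obtain ⟨c, hc, hcL⟩ := hL.exists_im_growth
  obtain ⟨c', hc', hcL'⟩ := hL'.exists_im_growth
  obtain ⟨B, hB0, hB⟩ := hL.exists_norm_le
  obtain ⟨B', hB0', hB'⟩ := hL'.exists_norm_le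
  set e := min c c' with he
  have he0 : 0 < e := lt_min hc hc'
  have hRR (τ : ℝ) : |(L τ).re| ≤ (max R R' : ℕ) := (hR τ).trans (by exact_mod_cast le_max_left _ _)
  have hRR' (τ : ℝ) : |(L' τ).re| ≤ (max R R' : ℕ) :=
    (hR' τ).trans (by exact_mod_cast le_max_right _ _)
  -- Both points lie at height at least `e |τ|`, on the same side of the real axis, and at distance
  -- `O(|τ|)`. The increment of `G` is therefore `O(|τ|⁻¹)`.
  have key : ∀ᶠ τ in cocompact ℝ,
      ‖G (L τ) - G (L' τ)‖ ≤ C / (e * |τ|) ^ 2 * (B * |τ| + B' * |τ| + |s - s'|) := by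
    filter_upwards [hcL, hcL', eventually_cocompact_le_abs e⁻¹] with τ ⟨h1, h2, h3⟩ ⟨h4, h5, h6⟩ h7
    have hY : 1 ≤ e * |τ| := by rwa [inv_le_iff_one_le_mul₀' he0] at h7
    have hτ : τ ≠ 0 := by rintro rfl; simp at h3; linarith
    have g1 : e * |τ| ≤ |(L τ).im| := le_trans (by gcongr; exact min_le_left _ _) h1
    have g2 : e * |τ| ≤ |(L' τ).im| := le_trans (by gcongr; exact min_le_right _ _) h4
    have hdist : ‖L τ - L' τ‖ ≤ B * |τ| + B' * |τ| + |s - s'| := by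
      have : L τ - L' τ = (L τ - s) - (L' τ - s') + ((s - s' : ℝ) : ℂ) := by push_cast; ring
      rw [this]
      refine (norm_add_le _ _).trans (add_le_add ((norm_sub_le _ _).trans
        (add_le_add (hB τ) (hB' τ))) ?_)
      rw [Complex.norm_real]; rfl
    refine le_trans ?_ (mul_le_mul_of_nonneg_left hdist (by positivity))
    rcases hτ.lt_or_gt with h | h
    · rw [abs_of_neg (hL.im_neg τ h)] at g1
      rw [abs_of_neg (hL'.im_neg τ h)] at g2
      refine norm_primitive_sub_le (convex_halfStrip_lower (max R R' : ℕ) (-(e * |τ|))) hCF hC hY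
        (fun z hz => ⟨hz.1, ?_⟩) (fun z hz => hG z (Or.inl ?_)) ⟨hRR τ, ?_⟩ ⟨hRR' τ, ?_⟩
      · have := hz.2; rw [abs_of_neg (show z.im < 0 by linarith)]; linarith
      · have := hz.2; exact ne_of_lt (by linarith)
      · linarith
      · linarith
    · rw [abs_of_pos (hL.im_pos τ h)] at g1
      rw [abs_of_pos (hL'.im_pos τ h)] at g2
      refine norm_primitive_sub_le (convex_halfStrip_upper (max R R' : ℕ) (e * |τ|)) hCF hC hY
        (fun z hz => ⟨hz.1, ?_⟩) (fun z hz => hG z (Or.inl ?_)) ⟨hRR τ, g1⟩ ⟨hRR' τ, g2⟩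
      · have := hz.2; rw [abs_of_pos (show 0 < z.im by linarith)]; exact this
      · have := hz.2; exact ne_of_gt (by linarith)
  have hlim : Tendsto (fun τ => G (L τ) - G (L' τ)) (cocompact ℝ) (𝓝 0) := by
    refine squeeze_zero_norm' key ?_
    have hi : Tendsto (fun τ : ℝ => |τ|⁻¹) (cocompact ℝ) (𝓝 0) :=
      tendsto_inv_atTop_zero.comp (tendsto_norm_cocompact_atTop (E := ℝ))
    have h1 : Tendsto (fun τ : ℝ => C / e ^ 2 * ((B + B') * |τ|⁻¹ + |s - s'| * |τ|⁻¹ ^ 2))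
        (cocompact ℝ) (𝓝 (C / e ^ 2 * ((B + B') * 0 + |s - s'| * 0 ^ 2))) :=
      ((hi.const_mul _).add ((hi.pow 2).const_mul _)).const_mul _
    simp only [mul_zero, add_zero, ne_eq, OfNat.ofNat_ne_zero, not_false_eq_true, zero_pow] at h1
    refine h1.congr' ?_
    filter_upwards [eventually_cocompact_le_abs 1] with τ hτ
    have : |τ| ≠ 0 := by positivity
    field_simp
  rw [contourIntegral, contourIntegral]
  congr 1
  have t1 := IsContour.tendsto_intervalIntegral (hL.contourIntegrable c1 hd)
  have t2 := IsContour.tendsto_intervalIntegral (hL'.contourIntegrable c2 hd)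
  refine sub_eq_zero.1 (tendsto_nhds_unique (t1.sub t2) ?_)
  have e1 : ∀ T : ℝ, (∫ τ in (-T)..T, F (L τ) * deriv L τ) - ∫ τ in (-T)..T, F (L' τ) * deriv L' τ
      = (G (L T) - G (L' T)) - (G (L (-T)) - G (L' (-T))) := fun T => by
    rw [hL.integral_eq_sub c1 fun τ => hG _ (hL.mem_slitDomain ha hb τ),
      hL'.integral_eq_sub c2 fun τ => hG _ (hL'.mem_slitDomain ha' hb' τ)]
    ring
  simp only [e1]
  have l1 := hlim.mono_left atTop_le_cocompact
  have l2 := (hlim.mono_left atBot_le_cocompact).comp tendsto_neg_atTop_atBot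
  simpa using l1.sub l2

/-! ### Residues -/

/-- A kernel with a simple pole of residue `1` at `-k` that decays in strips. -/
def poleKernel (k : ℝ) (z : ℂ) : ℂ := 1 / (z + k) - 1 / z

theorem hasStripDecay_poleKernel (k : ℝ) : HasStripDecay (poleKernel k) := by
  refine fun R => ⟨|k|, abs_nonneg _, fun z _ h2 => ?_⟩
  have hz : z.im ≠ 0 := by rintro h; simp [h] at h2; linarith
  have h0 : z ≠ 0 := by simpa using add_ofReal_ne_zero_of_im_ne_zero hz 0
  have hk := add_ofReal_ne_zero_of_im_ne_zero hz k
  have e : poleKernel k z = -k / ((z + k) * z) := by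
    rw [poleKernel]; field_simp; ring
  rw [e, norm_div, norm_neg, norm_mul, Complex.norm_real, Real.norm_eq_abs, sq]
  have h3 := abs_im_le_norm_add z k
  have h4 := Complex.abs_im_le_norm z
  have : 0 < |z.im| := by linarith
  gcongr

theorem continuousAt_poleKernel {k : ℝ} {z : ℂ} (h0 : z ≠ 0) (hk : z + k ≠ 0) :
    ContinuousAt (poleKernel k) z := by
  unfold poleKernel
  fun_prop (disch := assumption)

/-- The cut of `log (1 + k/z)` for `k > 0` is the segment from `-k` to `0`, so this primitive serves
contours crossing left of `-k`. The variant `log (-(1 + k/z))` has its cut on the real axis outside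
that segment and serves contours crossing inside it. -/
theorem hasDerivAt_log_one_add_div {k : ℝ} {z : ℂ} (h0 : z ≠ 0) (hk : z + k ≠ 0)
    (h : 1 + k / z ∈ Complex.slitPlane) :
    HasDerivAt (fun z => Complex.log (1 + k / z)) (poleKernel k z) z := by
  have h1 : HasDerivAt (fun z : ℂ => 1 + k / z) (-k / z ^ 2) z := by
    have := ((hasDerivAt_inv h0).const_mul (k : ℂ)).const_add 1
    simpa [div_eq_mul_inv] using this
  have h2 := h1.clog h
  have h3 : 1 + k / z ≠ 0 := Complex.slitPlane_ne_zero h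
  convert h2 using 1
  rw [poleKernel]
  have h4 : 1 + k / z = (z + k) / z := by field_simp
  rw [h4]
  field_simp
  ring

theorem hasDerivAt_log_neg_one_add_div {k : ℝ} {z : ℂ} (h0 : z ≠ 0) (hk : z + k ≠ 0)
    (h : -(1 + k / z) ∈ Complex.slitPlane) :
    HasDerivAt (fun z => Complex.log (-(1 + k / z))) (poleKernel k z) z := by
  have h1 : HasDerivAt (fun z : ℂ => -(1 + k / z)) (-(-k / z ^ 2)) z := by
    have := ((hasDerivAt_inv h0).const_mul (k : ℂ)).const_add 1
    refine HasDerivAt.neg ?_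
    simpa [div_eq_mul_inv] using this
  have h2 := h1.clog h
  convert h2 using 1
  rw [poleKernel]
  have h4 : 1 + k / z = (z + k) / z := by field_simp
  rw [h4]
  field_simp
  ring

namespace IsContour

variable {γ s : ℝ} {L : ℝ → ℂ}

theorem ne_ofReal (hL : IsContour γ s L) {a : ℝ} (h : s ≠ a) (τ : ℝ) : L τ ≠ a := by
  intro h1
  by_cases hτ : τ = 0
  · rw [hτ, hL.zero] at h1
    exact h (by exact_mod_cast h1)
  · apply hL.im_ne_zero hτ
    rw [h1]; simp

theorem continuous_poleKernel (hL : IsContour γ s L) {k : ℝ} (h0 : s ≠ 0) (hk : s ≠ -k) :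
    Continuous fun τ => poleKernel k (L τ) := by
  refine continuous_iff_continuousAt.2 fun τ => ?_
  refine ContinuousAt.comp (g := poleKernel k) (continuousAt_poleKernel ?_ ?_)
    hL.continuous.continuousAt
  · simpa using hL.ne_ofReal h0 τ
  · have := hL.ne_ofReal hk τ
    push_cast at this
    rwa [ne_eq, add_eq_zero_iff_eq_neg]

theorem tendsto_one_add_div (hL : IsContour γ s L) (k : ℝ) :
    Tendsto (fun τ => 1 + k / L τ) (cocompact ℝ) (𝓝 1) := by
  have h : Tendsto (fun τ => k / L τ) (cocompact ℝ) (𝓝 0) := by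
    refine squeeze_zero_norm (a := fun τ => |k| * ‖L τ‖⁻¹) (fun τ => ?_) ?_
    · rw [norm_div, Complex.norm_real, div_eq_mul_inv]; rfl
    · simpa using (tendsto_inv_atTop_zero.comp hL.tendsto_norm).const_mul |k|
  simpa using h.const_add (1 : ℂ)

/-- The primitive `log (1 + k/z)` tends to `log 1 = 0` at both ends. -/
theorem contourIntegral_poleKernel_of_lt (hL : IsContour γ s L) {k : ℝ} (hk : 0 < k)
    (hs : s < -k) : contourIntegral L (poleKernel k) = 0 := by
  have h0 : s ≠ 0 := by linarith
  have hsk : s ≠ -k := hs.ne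
  have hlog : Tendsto (fun τ => Complex.log (1 + k / L τ)) (cocompact ℝ) (𝓝 0) := by
    rw [← Complex.log_one]
    exact (continuousAt_clog Complex.one_mem_slitPlane).tendsto.comp (hL.tendsto_one_add_div k)
  rw [hL.contourIntegral_eq_of_tendsto (hL.continuous_poleKernel h0 hsk)
    (hasStripDecay_poleKernel k) (G := fun z => Complex.log (1 + k / z)) (fun τ => ?_)
    (hlog.mono_left atTop_le_cocompact) (hlog.mono_left atBot_le_cocompact)]
  · simp
  · have hz : L τ ≠ 0 := by simpa using hL.ne_ofReal h0 τ
    have hzk : L τ + k ≠ 0 := by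
      have := hL.ne_ofReal hsk τ
      push_cast at this
      rwa [ne_eq, add_eq_zero_iff_eq_neg]
    refine hasDerivAt_log_one_add_div hz hzk ?_
    by_cases hτ : τ = 0
    · rw [hτ, hL.zero]
      left
      rw [← Complex.ofReal_div, ← Complex.ofReal_one, ← Complex.ofReal_add, Complex.ofReal_re]
      have h1 : s < 0 := by linarith
      have : 1 + k / s = (s + k) / s := by field_simp
      rw [this]
      exact div_pos_of_neg_of_neg (by linarith) h1
    · right
      have := hL.im_ne_zero hτ
      simp [Complex.div_im, hk.ne', hz, this]

/-- The argument `-(1 + k/z)` tends to `-1`, and its imaginary part has the sign of `Im z`. The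
logarithm therefore tends to `πi` at the upper end and `-πi` at the lower, a total of `2πi`. -/
theorem contourIntegral_poleKernel_of_gt (hL : IsContour γ s L) {k : ℝ} (hk : 0 < k)
    (hs : -k < s) (hs0 : s < 0) : contourIntegral L (poleKernel k) = 1 := by
  have h0 : s ≠ 0 := hs0.ne
  have hsk : s ≠ -k := hs.ne'
  have him (τ : ℝ) : (-(1 + k / L τ)).im = k * (L τ).im / Complex.normSq (L τ) := by
    simp [Complex.div_im]
  have hlim := (hL.tendsto_one_add_div k).neg
  have htop : Tendsto (fun τ => Complex.log (-(1 + k / L τ))) atTop (𝓝 (Real.pi * Complex.I)) := by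
    have h1 := Complex.tendsto_log_nhdsWithin_im_nonneg_of_re_neg_of_im_zero (z := -1)
      (by simp) (by simp)
    simp only [norm_neg, norm_one, Real.log_one, Complex.ofReal_zero, zero_add] at h1
    refine h1.comp (tendsto_nhdsWithin_iff.2 ⟨hlim.mono_left atTop_le_cocompact, ?_⟩)
    filter_upwards [eventually_gt_atTop 0] with τ hτ
    have := hL.im_pos τ hτ
    change 0 ≤ (-(1 + k / L τ)).im
    rw [him]
    have := Complex.normSq_nonneg (L τ)
    positivity
  have hbot : Tendsto (fun τ => Complex.log (-(1 + k / L τ))) atBot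
      (𝓝 (-(Real.pi * Complex.I))) := by
    have h1 := Complex.tendsto_log_nhdsWithin_im_neg_of_re_neg_of_im_zero (z := -1)
      (by simp) (by simp)
    simp only [norm_neg, norm_one, Real.log_one, Complex.ofReal_zero, zero_sub] at h1
    refine h1.comp (tendsto_nhdsWithin_iff.2 ⟨hlim.mono_left atBot_le_cocompact, ?_⟩)
    filter_upwards [eventually_lt_atBot 0] with τ hτ
    have h2 := hL.im_neg τ hτ
    change (-(1 + k / L τ)).im < 0
    rw [him]
    refine div_neg_of_neg_of_pos (mul_neg_of_pos_of_neg hk h2) (Complex.normSq_pos.2 ?_)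
    simpa using hL.ne_ofReal h0 τ
  rw [hL.contourIntegral_eq_of_tendsto (hL.continuous_poleKernel h0 hsk)
    (hasStripDecay_poleKernel k) (G := fun z => Complex.log (-(1 + k / z))) (fun τ => ?_)
    htop hbot]
  · have : (Real.pi : ℂ) ≠ 0 := by exact_mod_cast Real.pi_ne_zero
    have := Complex.I_ne_zero
    field_simp
    ring
  · have hz : L τ ≠ 0 := by simpa using hL.ne_ofReal h0 τ
    have hzk : L τ + k ≠ 0 := by
      have := hL.ne_ofReal hsk τ
      push_cast at this
      rwa [ne_eq, add_eq_zero_iff_eq_neg]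
    refine hasDerivAt_log_neg_one_add_div hz hzk ?_
    by_cases hτ : τ = 0
    · rw [hτ, hL.zero]
      left
      rw [← Complex.ofReal_div, ← Complex.ofReal_one, ← Complex.ofReal_add, ← Complex.ofReal_neg,
        Complex.ofReal_re]
      have : -(1 + k / s) = (s + k) / (-s) := by field_simp
      rw [this]
      exact div_pos (by linarith) (by linarith)
    · right
      have := hL.im_ne_zero hτ
      simp [Complex.div_im, hk.ne', hz, this]

end IsContour

/-- Removal of finitely many isolated singularities. -/
theorem exists_differentiableOn_eqOn_diff {U : Set ℂ} (hU : IsOpen U) (S : Finset ℂ) {h : ℂ → ℂ}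
    (hd : ∀ z ∈ U, z ∉ S → DifferentiableAt ℂ h z)
    (hl : ∀ c ∈ S, Tendsto (fun z => (z - c) * h z) (𝓝[≠] c) (𝓝 0)) :
    ∃ H : ℂ → ℂ, DifferentiableOn ℂ H U ∧ ∀ z, z ∉ S → H z = h z := by
  classical
  refine ⟨fun z => if z ∈ S then limUnder (𝓝[≠] z) h else h z, fun z hz => ?_,
    fun z hz => if_neg hz⟩
  have hfin (c : ℂ) : IsOpen (((S.erase c : Finset ℂ) : Set ℂ)ᶜ) :=
    (Finset.finite_toSet _).isClosed.isOpen_compl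
  refine DifferentiableAt.differentiableWithinAt ?_
  by_cases hzS : z ∈ S
  · set W := U ∩ ((S.erase z : Finset ℂ) : Set ℂ)ᶜ with hW
    have hWz : W ∈ 𝓝 z := (hU.inter (hfin z)).mem_nhds ⟨hz, by simp⟩
    have h1 : DifferentiableOn ℂ h (W \ {z}) := by
      intro w hw
      refine (hd w hw.1.1 fun hwS => hw.1.2 ?_).differentiableWithinAt
      simp only [Finset.coe_erase, Set.mem_sdiff, Finset.mem_coe]
      exact ⟨hwS, hw.2⟩
    have h2 : (fun w => h w - h z) =o[𝓝[≠] z] fun w => (w - z)⁻¹ := by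
      rw [Asymptotics.isLittleO_iff_tendsto']
      · have h3 : Tendsto (fun w => (w - z) * h w - (w - z) * h z) (𝓝[≠] z) (𝓝 0) := by
          have h4 : Tendsto (fun w => (w - z) * h z) (𝓝[≠] z) (𝓝 ((z - z) * h z)) :=
            (Continuous.tendsto (by fun_prop) z).mono_left nhdsWithin_le_nhds
          simpa using (hl z hzS).sub h4
        refine h3.congr fun w => ?_
        rw [div_inv_eq_mul]; ring
      · filter_upwards [self_mem_nhdsWithin] with w hw h0
        exact absurd h0 (inv_ne_zero (sub_ne_zero.2 hw))
    have h3 := Complex.differentiableOn_update_limUnder_of_isLittleO hWz h1 h2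
    refine (h3.differentiableAt hWz).congr_of_eventuallyEq ?_
    filter_upwards [hWz] with w hw
    by_cases hwz : w = z
    · subst hwz; simp [hzS]
    · rw [Function.update_of_ne hwz, if_neg]
      intro hwS
      apply hw.2
      simp [hwS, hwz]
  · have hzo : ((S : Set ℂ)ᶜ) ∈ 𝓝 z := (Finset.finite_toSet S).isClosed.isOpen_compl.mem_nhds hzS
    refine (hd z hz hzS).congr_of_eventuallyEq ?_
    filter_upwards [hzo] with w hw using if_neg hw

theorem contourIntegral_add {L : ℝ → ℂ} {F G : ℂ → ℂ} (hF : ContourIntegrable L F)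
    (hG : ContourIntegrable L G) :
    contourIntegral L (fun z => F z + G z) = contourIntegral L F + contourIntegral L G := by
  simp only [contourIntegral, add_mul]
  rw [integral_add hF hG, mul_add]

theorem contourIntegral_const_mul {L : ℝ → ℂ} {F : ℂ → ℂ} (c : ℂ) :
    contourIntegral L (fun z => c * F z) = c * contourIntegral L F := by
  simp only [contourIntegral, mul_assoc]
  rw [integral_const_mul]
  ring

theorem ContourIntegrable.const_mul {L : ℝ → ℂ} {F : ℂ → ℂ} (hF : ContourIntegrable L F) (c : ℂ) :
    ContourIntegrable L (fun z => c * F z) := by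
  have := Integrable.const_mul hF c
  simpa only [ContourIntegrable, mul_assoc] using this

theorem ContourIntegrable.sum {ι : Type*} {L : ℝ → ℂ} {S : Finset ι} {F : ι → ℂ → ℂ}
    (hF : ∀ i ∈ S, ContourIntegrable L (F i)) :
    ContourIntegrable L (fun z => ∑ i ∈ S, F i z) := by
  simp only [ContourIntegrable, Finset.sum_mul]
  exact integrable_finsetSum _ hF

theorem contourIntegral_sum {ι : Type*} {L : ℝ → ℂ} {S : Finset ι} {F : ι → ℂ → ℂ}
    (hF : ∀ i ∈ S, ContourIntegrable L (F i)) :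
    contourIntegral L (fun z => ∑ i ∈ S, F i z) = ∑ i ∈ S, contourIntegral L (F i) := by
  simp only [contourIntegral, Finset.sum_mul]
  rw [integral_finsetSum _ hF, Finset.mul_sum]

theorem tendsto_mul_poleKernel {j k : ℕ} (hj : 1 ≤ j) :
    Tendsto (fun z : ℂ => (z - (-(j : ℂ))) * poleKernel k z) (𝓝[≠] (-(j : ℂ)))
      (𝓝 (if k = j then 1 else 0)) := by
  have hj0 : (-(j : ℂ)) ≠ 0 := by
    rw [neg_ne_zero]; exact_mod_cast (by omega : j ≠ 0)
  by_cases h : k = j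
  · subst h
    rw [if_pos rfl]
    have h1 : Tendsto (fun z : ℂ => 1 - (z + k) / z) (𝓝[≠] (-(k : ℂ)))
        (𝓝 (1 - (-(k : ℂ) + k) / (-(k : ℂ)))) := by
      refine Tendsto.mono_left (ContinuousAt.tendsto ?_) nhdsWithin_le_nhds
      fun_prop (disch := assumption)
    simp only [neg_add_cancel, zero_div, sub_zero] at h1
    refine h1.congr' ?_
    filter_upwards [self_mem_nhdsWithin,
      nhdsWithin_le_nhds (isOpen_ne.mem_nhds hj0)] with z hz hz0
    have h2 : z + k ≠ 0 := fun h => hz (eq_neg_of_add_eq_zero_left h)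
    have hz0' : z ≠ 0 := hz0
    rw [poleKernel]
    push_cast
    field_simp
    ring
  · rw [if_neg h]
    have h2 : -(j : ℂ) + (k : ℝ) ≠ 0 := by
      push_cast
      intro h3
      exact h (by exact_mod_cast (neg_add_eq_zero.1 h3).symm)
    have h1 : ContinuousAt (fun z : ℂ => (z - (-(j : ℂ))) * poleKernel k z) (-(j : ℂ)) :=
      (by fun_prop : ContinuousAt (fun z : ℂ => z - (-(j : ℂ))) _).mul
        (continuousAt_poleKernel hj0 h2)
    simpa using h1.tendsto.mono_left nhdsWithin_le_nhds

/-- The residue theorem for a shift of the contour across the points `-1, …, -m`. -/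
theorem contourIntegral_shift {m : ℕ} {γ s γ₀ s₀ : ℝ} {L L₀ : ℝ → ℂ}
    (hL : IsContour γ s L) (hs : -(m : ℝ) - 1 < s) (hs' : s < -(m : ℝ))
    (hL₀ : IsContour γ₀ s₀ L₀) (hs₀ : -1 < s₀) (hs₀' : s₀ < 0) {f : ℂ → ℂ} {r : ℕ → ℂ}
    (hf : ∀ z ∈ slitDomain (-(m : ℝ) - 1) 0, (∀ k ∈ Finset.Icc 1 m, z ≠ -(k : ℂ)) →
      DifferentiableAt ℂ f z)
    (hr : ∀ k ∈ Finset.Icc 1 m, Tendsto (fun z : ℂ => (z + k) * f z) (𝓝[≠] (-(k : ℂ))) (𝓝 (r k)))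
    (hd : HasStripDecay f) :
    ContourIntegrable L f ∧ ContourIntegrable L₀ f ∧
      contourIntegral L f = contourIntegral L₀ f - ∑ k ∈ Finset.Icc 1 m, r k := by
  classical
  have hm : (0 : ℝ) ≤ m := m.cast_nonneg
  have hcont : ∀ {γ s : ℝ} {L : ℝ → ℂ}, IsContour γ s L → -(m : ℝ) - 1 < s → s < 0 →
      (∀ k ∈ Finset.Icc 1 m, s ≠ -(k : ℝ)) → Continuous fun τ => f (L τ) := by
    intro γ s L hL h1 h2 h3
    refine continuous_iff_continuousAt.2 fun τ => ?_
    refine ContinuousAt.comp (g := f) (hf _ (hL.mem_slitDomain h1 h2 τ) fun k hk => ?_).continuousAt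
      hL.continuous.continuousAt
    simpa using hL.ne_ofReal (h3 k hk) τ
  have hne : ∀ k ∈ Finset.Icc 1 m, s < -(k : ℝ) := fun k hk => by
    have : (k : ℝ) ≤ m := by exact_mod_cast (Finset.mem_Icc.1 hk).2
    linarith
  have hne₀ : ∀ k ∈ Finset.Icc 1 m, -(k : ℝ) < s₀ := fun k hk => by
    have : (1 : ℝ) ≤ k := by exact_mod_cast (Finset.mem_Icc.1 hk).1
    linarith
  have hkpos : ∀ k ∈ Finset.Icc 1 m, (0 : ℝ) < k := fun k hk => by
    exact_mod_cast (Finset.mem_Icc.1 hk).1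
  have hs0 : s < 0 := by linarith
  have c1 := hcont hL hs hs0 fun k hk => (hne k hk).ne
  have c2 := hcont hL₀ (by linarith) hs₀' fun k hk => (hne₀ k hk).ne'
  have i1 := hL.contourIntegrable c1 hd
  have i2 := hL₀.contourIntegrable c2 hd
  refine ⟨i1, i2, ?_⟩
  -- Adding `p` cancels the principal parts of `f` at `-1, …, -m`. Its only further pole, at `0`,
  -- lies outside the slit domain.
  set p : ℂ → ℂ := fun z => ∑ k ∈ Finset.Icc 1 m, (-r k) * poleKernel k z with hp
  have hpd : HasStripDecay p :=
    HasStripDecay.sum _ fun k _ => (hasStripDecay_poleKernel k).const_mul _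
  set S : Finset ℂ := (Finset.Icc 1 m).image fun k : ℕ => -(k : ℂ) with hS
  have hmemS {z : ℂ} (hz : z ∉ S) : ∀ k ∈ Finset.Icc 1 m, z ≠ -(k : ℂ) := by
    rintro k hk rfl
    exact hz (Finset.mem_image_of_mem _ hk)
  obtain ⟨H, hH, hHS⟩ := exists_differentiableOn_eqOn_diff (isOpen_slitDomain (-(m : ℝ) - 1) 0) S
    (h := fun z => f z + p z) (fun z hz hzS => by
      refine (hf z hz (hmemS hzS)).add (DifferentiableAt.fun_sum fun k hk => ?_)
      have h0 : z ≠ 0 := by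
        rintro rfl
        rcases hz with h | h
        · simp at h
        · simp at h
      have h1 : z + k ≠ 0 := fun h => hmemS hzS k hk (eq_neg_of_add_eq_zero_left h)
      unfold poleKernel
      push_cast
      fun_prop (disch := assumption)) (fun c hc => by
      obtain ⟨j, hj, rfl⟩ := Finset.mem_image.1 hc
      have h1 := (hr j hj).add (tendsto_finsetSum (Finset.Icc 1 m) fun k _ =>
        (tendsto_mul_poleKernel (k := k) (Finset.mem_Icc.1 hj).1).const_mul (-r k))
      have h2 : r j + ∑ k ∈ Finset.Icc 1 m, -r k * (if k = j then 1 else 0) = 0 := by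
        simp only [mul_ite, mul_one, mul_zero, Finset.sum_ite_eq', if_pos hj, add_neg_cancel]
      rw [h2] at h1
      refine h1.congr fun z => ?_
      rw [hp, mul_add, Finset.mul_sum, sub_neg_eq_add]
      congr 1
      exact Finset.sum_congr rfl fun k _ => by ring)
  have hSim {z : ℂ} (hz : 1 ≤ |z.im|) : z ∉ S := by
    intro h
    obtain ⟨j, hj, rfl⟩ := Finset.mem_image.1 h
    simp at hz
    linarith
  have hHd : HasStripDecay H := by
    intro R
    obtain ⟨C, hC, h⟩ := hd.add hpd R
    exact ⟨C, hC, fun z h1 h2 => by rw [hHS z (hSim h2)]; exact h z h1 h2⟩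
  have hcauchy := contourIntegral_eq_of_slitDomain hL hL₀ (by linarith) hs0 (by linarith) hs₀' hH hHd
  have hsplit : ∀ {γ s : ℝ} {L : ℝ → ℂ}, IsContour γ s L → s < 0 →
      (∀ k ∈ Finset.Icc 1 m, s ≠ -(k : ℝ)) → ContourIntegrable L f →
      contourIntegral L H = contourIntegral L f -
        ∑ k ∈ Finset.Icc 1 m, r k * contourIntegral L (poleKernel k) := by
    intro γ s L hL h0 hk hi
    have e1 : contourIntegral L H = contourIntegral L (fun z => f z + p z) := by
      simp only [contourIntegral]
      congr 2
      ext τ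
      rw [hHS]
      intro h
      obtain ⟨j, hj, hj'⟩ := Finset.mem_image.1 h
      refine hL.ne_ofReal (hk j hj) τ ?_
      rw [← hj']; simp
    have hik : ∀ k ∈ Finset.Icc 1 m, ContourIntegrable L (fun z => (-r k) * poleKernel k z) :=
      fun k hk' => (hL.contourIntegrable (hL.continuous_poleKernel h0.ne (hk k hk'))
        (hasStripDecay_poleKernel k)).const_mul _
    rw [e1, contourIntegral_add hi (ContourIntegrable.sum hik), contourIntegral_sum hik,
      sub_eq_add_neg, ← Finset.sum_neg_distrib]
    congr 1
    refine Finset.sum_congr rfl fun k _ => ?_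
    rw [contourIntegral_const_mul, neg_mul]
  rw [hsplit hL hs0 (fun k hk => (hne k hk).ne) i1,
    hsplit hL₀ hs₀' (fun k hk => (hne₀ k hk).ne') i2] at hcauchy
  -- `L` crosses to the left of every pole `-k` and contributes `0`; `L₀` crosses between all of
  -- them and `0` and contributes `r k`.
  rw [Finset.sum_congr rfl fun k hk => by
      rw [hL.contourIntegral_poleKernel_of_lt (hkpos k hk) (hne k hk), mul_zero],
    Finset.sum_const_zero, sub_zero] at hcauchy
  rw [hcauchy]
  congr 1
  refine Finset.sum_congr rfl fun k hk => ?_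
  rw [hL₀.contourIntegral_poleKernel_of_gt (hkpos k hk) (hne₀ k hk) hs₀', mul_one]

/-! ### The kernels: holomorphy and decay -/

/-- Since `1/Γ` is entire, only the poles of `Γ(-z)` at `0, 1, 2, …` matter; the quotient is regular
at `-1, …, -m`. -/
theorem differentiableAt_gammaRatio (m : ℕ) {z : ℂ} (hz : ∀ n : ℕ, z ≠ n) :
    DifferentiableAt ℂ (gammaRatio m) z := by
  have h1 : DifferentiableAt ℂ (fun z : ℂ => Complex.Gamma (-z)) z :=
    (Complex.differentiableAt_Gamma (-z) fun n h => hz n (neg_injective h)).comp z (by fun_prop)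
  have h2 : DifferentiableAt ℂ (fun z : ℂ => (Complex.Gamma (z + 1 + m))⁻¹) z :=
    DifferentiableAt.comp (g := fun s : ℂ => (Complex.Gamma s)⁻¹) (f := fun z : ℂ => z + 1 + m) z
      (Complex.differentiable_one_div_Gamma _) (by fun_prop)
  have h3 := h1.mul h2
  refine h3.congr_of_eventuallyEq (Eventually.of_forall fun w => ?_)
  simp [gammaRatio, div_eq_mul_inv]

theorem differentiableAt_two_cpow (z : ℂ) : DifferentiableAt ℂ (fun z : ℂ => (2 : ℂ) ^ z) z :=
  DifferentiableAt.const_cpow differentiableAt_id (Or.inl two_ne_zero)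

theorem differentiableAt_kernelPlus (m : ℕ) {φ : ℝ → ℂ} (hφ : IsTest φ) {z : ℂ}
    (hz : ∀ n : ℤ, z ≠ n) : DifferentiableAt ℂ (kernelPlus m φ) z := by
  refine (differentiableAt_gammaRatio m fun n => by simpa using hz n).mul
    ((differentiableAt_two_cpow z).mul (differentiableAt_rieszPlus hφ fun j h => ?_))
  apply hz (-(j + 1))
  push_cast
  linear_combination h

/-- Pairing `t_-^z` with `φ` is pairing `t_+^z` with the reflection of `φ`. Holomorphy and decay
thus pass from `kernelPlus` to `kernel` through the multipliers `cot` and `1 / sin`. -/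
theorem kernel_eq (m : ℕ) (φ : ℝ → ℂ) (z : ℂ) :
    kernel m φ z = kernelPlus m φ z * (Complex.cos (Real.pi * z) / Complex.sin (Real.pi * z)) +
      kernelPlus m (fun x => φ (-x)) z * (1 / Complex.sin (Real.pi * z)) := by
  rw [kernel, kernelPlus, kernelPlus, rieszMinus, Complex.tan_eq_sin_div_cos, div_div_eq_mul_div]
  ring

theorem sin_pi_mul_ne_zero {z : ℂ} (hz : ∀ n : ℤ, z ≠ n) : Complex.sin (Real.pi * z) ≠ 0 := by
  intro h
  obtain ⟨n, hn⟩ := Complex.sin_eq_zero_iff.1 h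
  have hpi : (Real.pi : ℂ) ≠ 0 := by exact_mod_cast Real.pi_ne_zero
  exact hz n (mul_left_cancel₀ hpi (by rw [hn]; ring))

theorem differentiableAt_kernel (m : ℕ) {φ : ℝ → ℂ} (hφ : IsTest φ) {z : ℂ}
    (hz : ∀ n : ℤ, z ≠ n) : DifferentiableAt ℂ (kernel m φ) z := by
  have h0 := sin_pi_mul_ne_zero hz
  rw [show kernel m φ = _ from funext (kernel_eq m φ)]
  have h1 : DifferentiableAt ℂ (fun z : ℂ => Complex.sin (Real.pi * z)) z := by fun_prop
  have h2 : DifferentiableAt ℂ (fun z : ℂ => Complex.cos (Real.pi * z)) z := by fun_prop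
  exact ((differentiableAt_kernelPlus m hφ hz).mul (h2.div h1 h0)).add
    ((differentiableAt_kernelPlus m hφ.comp_neg hz).mul ((differentiableAt_const 1).div h1 h0))

theorem sinh_le_norm_sin (w : ℂ) : Real.sinh |w.im| ≤ ‖Complex.sin w‖ := by
  have h1 : ‖Complex.exp (-w * Complex.I)‖ = Real.exp w.im := by
    rw [Complex.norm_exp]; simp
  have h2 : ‖Complex.exp (w * Complex.I)‖ = Real.exp (-w.im) := by
    rw [Complex.norm_exp]; simp
  have h3 := abs_norm_sub_norm_le (Complex.exp (-w * Complex.I)) (Complex.exp (w * Complex.I))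
  rw [h1, h2] at h3
  rw [Complex.sin, norm_div, norm_mul, Complex.norm_I, mul_one, Complex.norm_ofNat]
  rw [← Real.abs_sinh, Real.sinh_eq, abs_div, abs_two]
  gcongr

theorem norm_cos_le_cosh (w : ℂ) : ‖Complex.cos w‖ ≤ Real.cosh |w.im| := by
  have h1 : ‖Complex.exp (-w * Complex.I)‖ = Real.exp w.im := by
    rw [Complex.norm_exp]; simp
  have h2 : ‖Complex.exp (w * Complex.I)‖ = Real.exp (-w.im) := by
    rw [Complex.norm_exp]; simp
  have h3 := norm_add_le (Complex.exp (w * Complex.I)) (Complex.exp (-w * Complex.I))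
  rw [h1, h2] at h3
  rw [Complex.cos, norm_div, Complex.norm_ofNat, Real.cosh_abs, Real.cosh_eq]
  rw [add_comm (Real.exp w.im)]
  gcongr

theorem one_le_sinh_pi_mul {y : ℝ} (hy : 1 ≤ |y|) : 1 ≤ Real.sinh |Real.pi * y| := by
  have h : 1 ≤ |Real.pi * y| := by
    rw [abs_mul, abs_of_pos Real.pi_pos]
    nlinarith [Real.pi_gt_three]
  exact h.trans (Real.self_le_sinh_iff.2 (by linarith))

theorem norm_one_div_sin_pi_mul_le {z : ℂ} (hz : 1 ≤ |z.im|) :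
    ‖1 / Complex.sin (Real.pi * z)‖ ≤ 2 := by
  have h1 := sinh_le_norm_sin (Real.pi * z)
  have h2 := one_le_sinh_pi_mul hz
  have him : ((Real.pi : ℂ) * z).im = Real.pi * z.im := by simp
  rw [him] at h1
  rw [norm_div, norm_one, div_le_iff₀ (by linarith)]
  linarith

theorem norm_cos_div_sin_pi_mul_le {z : ℂ} (hz : 1 ≤ |z.im|) :
    ‖Complex.cos (Real.pi * z) / Complex.sin (Real.pi * z)‖ ≤ 2 := by
  have h1 := sinh_le_norm_sin (Real.pi * z)
  have h2 := one_le_sinh_pi_mul hz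
  have h3 := norm_cos_le_cosh (Real.pi * z)
  have him : ((Real.pi : ℂ) * z).im = Real.pi * z.im := by simp
  rw [him] at h1 h3
  -- As `sinh ≥ 1` here, `cosh² = 1 + sinh² ≤ 2 sinh²`.
  have h4 := Real.cosh_sq (|Real.pi * z.im|)
  have h5 := Real.cosh_pos (|Real.pi * z.im|)
  rw [norm_div, div_le_iff₀ (by linarith)]
  nlinarith

/-- A holomorphic factor that is bounded away from the real axis preserves rapid decay. -/
theorem hasStripDecay_kernelPlus_mul (m : ℕ) {φ : ℝ → ℂ} (hφ : IsTest φ) {q : ℂ → ℂ}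
    (hq : ∀ z : ℂ, 1 ≤ |z.im| → ‖q z‖ ≤ 2) : HasStripDecay (fun z => kernelPlus m φ z * q z) := by
  intro R
  obtain ⟨C, A, hC, h1⟩ := norm_gammaRatio_le m R
  obtain ⟨D, hD, h2⟩ := norm_rieszPlus_le hφ R (A + 2)
  refine ⟨C * (2 ^ R * D) * 2, by positivity, fun z hz1 hz2 => ?_⟩
  have h3 : ‖(2 : ℂ) ^ z‖ ≤ 2 ^ R := by
    have : ((2 : ℝ) : ℂ) = 2 := by norm_num
    rw [← this, Complex.norm_cpow_eq_rpow_re_of_pos two_pos, ← Real.rpow_natCast]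
    exact Real.rpow_le_rpow_of_exponent_le one_le_two ((le_abs_self _).trans hz1)
  have h0 : 0 < |z.im| := by linarith
  calc ‖kernelPlus m φ z * q z‖
      = ‖gammaRatio m z‖ * (‖(2 : ℂ) ^ z‖ * ‖rieszPlus z φ‖) * ‖q z‖ := by
        rw [kernelPlus, norm_mul, norm_mul, norm_mul]
    _ ≤ (C * |z.im| ^ A) * (2 ^ R * (D / |z.im| ^ (A + 2))) * 2 := by
        gcongr
        · exact h1 z hz1 hz2
        · exact h2 z hz1 hz2
        · exact hq z hz2
    _ = _ := by rw [pow_add]; field_simp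

theorem hasStripDecay_kernelPlus (m : ℕ) {φ : ℝ → ℂ} (hφ : IsTest φ) :
    HasStripDecay (kernelPlus m φ) := by
  simpa using hasStripDecay_kernelPlus_mul m hφ (q := fun _ => 1) (fun z _ => by simp)

theorem hasStripDecay_kernel (m : ℕ) {φ : ℝ → ℂ} (hφ : IsTest φ) :
    HasStripDecay (kernel m φ) := by
  rw [show kernel m φ = _ from funext (kernel_eq m φ)]
  exact (hasStripDecay_kernelPlus_mul m hφ fun z => norm_cos_div_sin_pi_mul_le).add
    (hasStripDecay_kernelPlus_mul m hφ.comp_neg fun z => norm_one_div_sin_pi_mul_le)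

theorem ne_intCast_of_mem_slitDomain {m : ℕ} {z : ℂ} (hz : z ∈ slitDomain (-(m : ℝ) - 1) 0)
    (h : ∀ k ∈ Finset.Icc 1 m, z ≠ -(k : ℂ)) (n : ℤ) : z ≠ n := by
  rintro rfl
  rcases hz with hz | ⟨h1, h2⟩
  · simp at hz
  · simp only [Complex.intCast_re] at h1 h2
    have h3 : -(m : ℤ) - 1 < n := by exact_mod_cast h1
    have h4 : n < 0 := by exact_mod_cast h2
    obtain ⟨k, hk⟩ := Int.eq_ofNat_of_zero_le (show 0 ≤ -n by omega)
    refine h k (Finset.mem_Icc.2 (by omega)) ?_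
    have : n = -(k : ℤ) := by omega
    rw [this]; push_cast; rfl

/-! ### The kernels: residues -/

/-- The coefficient of `⟨x_+^z, φ⟩` that stays regular at `z = -n-1`. -/
def rieszCoeff (n : ℕ) (z : ℂ) : ℂ := (-1 : ℂ) ^ (n + 1) / ∏ j ∈ Finset.range n, (z + j + 1)

theorem prod_range_sub_eq (n : ℕ) :
    ∏ j ∈ Finset.range n, (-((n : ℂ) + 1) + j + 1) = (-1) ^ n * n.factorial := by
  rw [← Finset.prod_range_reflect, ← Finset.prod_range_add_one_eq_factorial]
  push_cast
  rw [← Finset.card_range n, ← Finset.prod_const, Finset.card_range, ← Finset.prod_mul_distrib]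
  refine Finset.prod_congr rfl fun j hj => ?_
  have : j + 1 ≤ n := Finset.mem_range.1 hj
  rw [Nat.sub_sub, Nat.cast_sub (by omega)]
  push_cast
  ring

theorem rieszCoeff_neg (n : ℕ) : rieszCoeff n (-((n : ℂ) + 1)) = -1 / n.factorial := by
  rw [rieszCoeff, prod_range_sub_eq, pow_succ]
  have : ((-1 : ℂ)) ^ n ≠ 0 := pow_ne_zero _ (by norm_num)
  have h2 : (n.factorial : ℂ) ≠ 0 := by exact_mod_cast n.factorial_ne_zero
  field_simp

theorem continuousAt_rieszCoeff (n : ℕ) : ContinuousAt (rieszCoeff n) (-((n : ℂ) + 1)) := by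
  unfold rieszCoeff
  refine ContinuousAt.div (by fun_prop) (by fun_prop) ?_
  rw [prod_range_sub_eq]
  exact mul_ne_zero (pow_ne_zero _ (by norm_num)) (by exact_mod_cast n.factorial_ne_zero)

/-- After `n + 1` integrations by parts, the last factor `z + n + 1` is the only one vanishing at
`-n-1`; multiplication removes it. -/
theorem eventually_mul_rieszPlus {φ : ℝ → ℂ} (hφ : IsTest φ) (n : ℕ) :
    ∀ᶠ z in 𝓝[≠] (-((n : ℂ) + 1)), (z + (n + 1)) * rieszPlus z φ =
      rieszCoeff n z * mellin (iteratedDeriv (n + 1) φ) (z + n + 2) := by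
  have h := eventually_rieszPlus_eq hφ (n := n + 1) (z := -((n : ℂ) + 1)) (by simp)
  filter_upwards [nhdsWithin_le_nhds h, self_mem_nhdsWithin] with z hz hne
  have h1 : z + n + 1 ≠ 0 := fun h => hne (by
    rw [Set.mem_singleton_iff]; linear_combination h)
  rw [hz, rieszAux, rieszCoeff, Finset.prod_range_succ]
  push_cast
  rw [show z + ((n : ℂ) + 1) + 1 = z + n + 2 by ring, div_mul_eq_div_div, ← add_assoc]
  field_simp

theorem mellin_iteratedDeriv_succ_one {φ : ℝ → ℂ} (hφ : IsTest φ) (n : ℕ) :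
    mellin (iteratedDeriv (n + 1) φ) 1 = -iteratedDeriv n φ 0 := by
  have h := HasCompactSupport.integral_Ioi_deriv_eq
    ((hφ.iteratedDeriv n).contDiff.of_le (by norm_cast))
    (hφ.iteratedDeriv n).hasCompactSupport 0
  rw [← h, mellin, iteratedDeriv_succ]
  simp

theorem hasDerivAt_mellin_shift {ψ : ℝ → ℂ} (hψ : IsTest ψ) (n : ℕ) :
    HasDerivAt (fun z : ℂ => mellin ψ (z + n + 2)) (mellin (fun t => Real.log t • ψ t) 1)
      (-((n : ℂ) + 1)) := by
  have e : (-((n : ℂ) + 1) + n + 2) = 1 := by ring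
  have h1 := (mellin_hasDerivAt_of_hasCompactSupport hψ.continuous hψ.hasCompactSupport
    (s := 1) (by simp)).2
  rw [← e] at h1
  have h2 : HasDerivAt (fun z : ℂ => z + n + 2) 1 (-((n : ℂ) + 1)) :=
    ((hasDerivAt_id _).add_const _).add_const _
  have h3 := HasDerivAt.comp (-((n : ℂ) + 1)) h1 h2
  rw [mul_one, e] at h3
  exact h3

/-- The regular coefficient tends to `-1/n!`, and the Mellin transform at `1` is the integral of a
derivative over `(0, ∞)`, namely `-φ^(n)(0)`. -/
theorem tendsto_mul_rieszPlus {φ : ℝ → ℂ} (hφ : IsTest φ) (n : ℕ) :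
    Tendsto (fun z : ℂ => (z + (n + 1)) * rieszPlus z φ) (𝓝[≠] (-((n : ℂ) + 1)))
      (𝓝 (iteratedDeriv n φ 0 / n.factorial)) := by
  have h1 : Tendsto (fun z : ℂ => rieszCoeff n z * mellin (iteratedDeriv (n + 1) φ) (z + n + 2))
      (𝓝 (-((n : ℂ) + 1))) (𝓝 (rieszCoeff n (-((n : ℂ) + 1)) *
        mellin (iteratedDeriv (n + 1) φ) (-((n : ℂ) + 1) + n + 2))) :=
    ((continuousAt_rieszCoeff n).mul
      (hasDerivAt_mellin_shift (hφ.iteratedDeriv (n + 1)) n).continuousAt).tendsto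
  rw [show (-((n : ℂ) + 1) + n + 2) = 1 by ring, mellin_iteratedDeriv_succ_one hφ,
    rieszCoeff_neg, show -1 / (n.factorial : ℂ) * -iteratedDeriv n φ 0 =
      iteratedDeriv n φ 0 / n.factorial by ring] at h1
  refine (h1.mono_left nhdsWithin_le_nhds).congr' ?_
  filter_upwards [eventually_mul_rieszPlus hφ n] with z hz using hz.symm

theorem locallyIntegrable_log : LocallyIntegrable Real.log volume := by
  rw [locallyIntegrable_iff]
  intro K hK
  obtain ⟨R, hR⟩ := hK.isBounded.subset_closedBall 0
  refine IntegrableOn.mono_set ?_ hR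
  rw [Real.closedBall_eq_Icc, integrableOn_Icc_iff_integrableOn_Ioc]
  by_cases h : 0 - R ≤ 0 + R
  · rw [← intervalIntegrable_iff_integrableOn_Ioc_of_le h]
    exact intervalIntegral.intervalIntegrable_log'
  · rw [Set.Ioc_eq_empty_of_le (by linarith)]
    exact integrableOn_empty

theorem integrable_log_smul {ψ : ℝ → ℂ} (hψ : IsTest ψ) :
    Integrable fun x : ℝ => Real.log x • ψ x :=
  locallyIntegrable_log.integrable_smul_right_of_hasCompactSupport hψ.continuous
    hψ.hasCompactSupport

/-- The finite part `⟨x^{-n-1}, φ⟩` through the locally integrable function `log |x|`. -/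
theorem tendsto_rieszSum {φ : ℝ → ℂ} (hφ : IsTest φ) (n : ℕ) :
    Tendsto (fun z : ℂ => rieszSum (n + 1) z φ) (𝓝[≠] (-((n : ℂ) + 1)))
      (𝓝 (-1 / n.factorial * ∫ x : ℝ, Real.log x • iteratedDeriv (n + 1) φ x)) := by
  set a := iteratedDeriv (n + 1) φ with ha
  set b := iteratedDeriv (n + 1) (fun x => φ (-x)) with hb
  have hbx (x : ℝ) : b x = (-1) ^ (n + 1) * a (-x) := by
    rw [hb, iteratedDeriv_comp_neg, Complex.real_smul]
    push_cast
    rfl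
  have hta := hφ.iteratedDeriv (n + 1)
  have htb := hφ.comp_neg.iteratedDeriv (n + 1)
  -- `M` is the common numerator of the two halves over `z + n + 1`. The boundary values `φ^(n)(0)`
  -- cancel, so `M` vanishes at `-n-1` and the quotient is a difference quotient. Its limit `M'`
  -- carries the weight `log`, and the half-lines combine because `Real.log` is even.
  set M : ℂ → ℂ := fun z => mellin a (z + n + 2) + (-1) ^ (n + 1) * mellin b (z + n + 2) with hM
  have hM0 : M (-((n : ℂ) + 1)) = 0 := by
    simp only [hM]
    rw [show (-((n : ℂ) + 1) + n + 2) = 1 by ring, mellin_iteratedDeriv_succ_one hφ,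
      mellin_iteratedDeriv_succ_one hφ.comp_neg, iteratedDeriv_comp_neg, Complex.real_smul]
    push_cast
    have : ((-1 : ℂ) ^ n) * (-1) ^ n = 1 := by rw [← mul_pow]; simp
    rw [neg_zero, pow_succ]
    linear_combination iteratedDeriv n φ 0 * this
  have hsq : ((-1 : ℂ) ^ (n + 1)) * (-1) ^ (n + 1) = 1 := by rw [← mul_pow]; simp
  have hD : HasDerivAt M (∫ x : ℝ, Real.log x • a x) (-((n : ℂ) + 1)) := by
    have h1 := (hasDerivAt_mellin_shift hta n).add
      ((hasDerivAt_mellin_shift htb n).const_mul ((-1 : ℂ) ^ (n + 1)))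
    have hint : Integrable fun x : ℝ => Real.log x • a x := integrable_log_smul hta
    have hval : ∫ x : ℝ, Real.log x • a x = mellin (fun t => Real.log t • a t) 1 +
        (-1) ^ (n + 1) * mellin (fun t => Real.log t • b t) 1 := by
      rw [← integral_add_compl measurableSet_Ioi hint (s := Set.Ioi (0 : ℝ)), Set.compl_Ioi,
        mellin, mellin, ← integral_const_mul]
      congr 1
      · simp
      · have h2 := integral_comp_neg_Ioi (0 : ℝ) fun x => Real.log x • a x
        rw [neg_zero] at h2
        rw [← h2]
        refine setIntegral_congr_fun measurableSet_Ioi fun x _ => ?_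
        simp only [sub_self, Complex.cpow_zero, one_smul, hbx, Real.log_neg_eq_log,
          Complex.real_smul]
        linear_combination -(Real.log x * a (-x)) * hsq
    rw [hval]
    exact h1
  have hslope := hD.tendsto_slope
  have h2 := ((continuousAt_rieszCoeff n).tendsto.mono_left nhdsWithin_le_nhds).mul hslope
  rw [rieszCoeff_neg] at h2
  refine h2.congr' ?_
  filter_upwards [eventually_mul_rieszPlus hφ n, eventually_mul_rieszPlus hφ.comp_neg n,
    self_mem_nhdsWithin] with z h3 h4 hne
  have h1 : z + (n + 1) ≠ 0 := fun h => hne (by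
    rw [Set.mem_singleton_iff]; linear_combination h)
  rw [slope_def_field, hM0, sub_zero, sub_neg_eq_add]
  rw [rieszSum, rieszMinus, ← mul_div_assoc, div_eq_iff h1]
  simp only [hM]
  linear_combination -h3 - (-1) ^ (n + 1) * h4

theorem invPow_succ {φ : ℝ → ℂ} (hφ : IsTest φ) (n : ℕ) :
    invPow (n + 1) φ = -1 / n.factorial * ∫ x : ℝ, Real.log x • iteratedDeriv (n + 1) φ x := by
  have h := tendsto_rieszSum hφ n
  rw [invPow]
  push_cast
  exact h.limUnder_eq

theorem gammaRatio_neg_natCast {m n : ℕ} (h : n + 1 ≤ m) :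
    gammaRatio m (-((n : ℂ) + 1)) = n.factorial / (m - (n + 1)).factorial := by
  rw [gammaRatio, neg_neg, Complex.Gamma_nat_eq_factorial]
  congr 1
  rw [← Complex.Gamma_nat_eq_factorial, Nat.cast_sub h]
  congr 1
  push_cast
  ring

theorem continuousAt_gammaRatio_neg (m n : ℕ) :
    ContinuousAt (gammaRatio m) (-((n : ℂ) + 1)) := by
  refine (differentiableAt_gammaRatio m fun k h => ?_).continuousAt
  have h1 : ((n + 1 + k : ℕ) : ℂ) = 0 := by push_cast; linear_combination -h
  exact absurd (Nat.cast_eq_zero.1 h1) (by omega)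

theorem two_cpow_neg_natCast (n : ℕ) : (2 : ℂ) ^ (-((n : ℂ) + 1)) = 1 / 2 ^ (n + 1) := by
  rw [Complex.cpow_neg, one_div]
  norm_cast

theorem tendsto_gammaRatio_mul_two_cpow {m n : ℕ} (h : n + 1 ≤ m) :
    Tendsto (fun z : ℂ => gammaRatio m z * (2 : ℂ) ^ z) (𝓝[≠] (-((n : ℂ) + 1)))
      (𝓝 (n.factorial / (2 ^ (n + 1) * (m - (n + 1)).factorial))) := by
  have h1 := (continuousAt_gammaRatio_neg m n).tendsto.mul
    (differentiableAt_two_cpow (-((n : ℂ) + 1))).continuousAt.tendsto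
  rw [gammaRatio_neg_natCast h, two_cpow_neg_natCast, div_mul_div_comm, mul_one,
    mul_comm (((m - (n + 1)).factorial : ℂ))] at h1
  exact h1.mono_left nhdsWithin_le_nhds

theorem tendsto_mul_kernelPlus {m n : ℕ} (h : n + 1 ≤ m) {φ : ℝ → ℂ} (hφ : IsTest φ) :
    Tendsto (fun z : ℂ => (z + (n + 1)) * kernelPlus m φ z) (𝓝[≠] (-((n : ℂ) + 1)))
      (𝓝 (iteratedDeriv n φ 0 / (2 ^ (n + 1) * (m - (n + 1)).factorial))) := by
  have h1 := (tendsto_gammaRatio_mul_two_cpow h).mul (tendsto_mul_rieszPlus hφ n)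
  have h2 : (n.factorial : ℂ) ≠ 0 := by exact_mod_cast n.factorial_ne_zero
  convert h1 using 1
  · ext z; rw [kernelPlus]; ring
  · congr 1; field_simp

theorem sin_cos_pi_mul (z : ℂ) (k : ℕ) :
    Complex.sin (Real.pi * z) = (-1) ^ k * Complex.sin (Real.pi * (z + k)) ∧
    Complex.cos (Real.pi * z) = (-1) ^ k * Complex.cos (Real.pi * (z + k)) := by
  induction k with
  | zero => simp
  | succ k ih =>
    have e : Real.pi * (z + (k + 1 : ℕ)) = Real.pi * (z + k) + Real.pi := by push_cast; ring
    rw [e, Complex.sin_add_pi, Complex.cos_add_pi, ih.1, ih.2]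
    constructor <;> ring

theorem tendsto_div_sin_pi_mul :
    Tendsto (fun w : ℂ => w / Complex.sin (Real.pi * w)) (𝓝[≠] 0) (𝓝 (1 / Real.pi)) := by
  have h1 : HasDerivAt (fun w : ℂ => Complex.sin (Real.pi * w)) Real.pi 0 := by
    have h2 : HasDerivAt (fun w : ℂ => (Real.pi : ℂ) * w) Real.pi 0 := by
      simpa using (hasDerivAt_id (0 : ℂ)).const_mul (Real.pi : ℂ)
    simpa using h2.csin
  have h3 := h1.tendsto_slope.inv₀ (by exact_mod_cast Real.pi_ne_zero)
  rw [← one_div] at h3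
  refine h3.congr fun w => ?_
  simp [slope_def_field]

/-- Put `k = n + 1`, `w = z + k`. Shifting by `kπ` turns the bracket, apart from `2^z`, into `t_+^z
cot πw + (-1)^k t_-^z / sin πw = (t_+^z + (-1)^k t_-^z) / sin πw - t_+^z tan (πw/2)`. After
multiplication by `w`, the first term tends to `t^{-k} / π`. In the second, `w t_+^z` has a finite
limit while the tangent tends to `0`. -/
theorem tendsto_mul_kernel {m n : ℕ} (h : n + 1 ≤ m) {φ : ℝ → ℂ} (hφ : IsTest φ) :
    Tendsto (fun z : ℂ => (z + (n + 1)) * kernel m φ z) (𝓝[≠] (-((n : ℂ) + 1)))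
      (𝓝 (n.factorial / (2 ^ (n + 1) * (m - (n + 1)).factorial) *
        (invPow (n + 1) φ * (1 / Real.pi)))) := by
  set c : ℂ := -((n : ℂ) + 1) with hc
  have hshift : Tendsto (fun z : ℂ => z + (n + 1)) (𝓝[≠] c) (𝓝[≠] 0) := by
    refine tendsto_nhdsWithin_iff.2 ⟨?_, ?_⟩
    · have : Tendsto (fun z : ℂ => z + (n + 1)) (𝓝 c) (𝓝 (c + (n + 1))) :=
        Continuous.tendsto (by fun_prop) c
      rw [hc, neg_add_cancel] at this
      exact this.mono_left nhdsWithin_le_nhds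
    · filter_upwards [self_mem_nhdsWithin] with z hz h0
      exact hz (eq_neg_of_add_eq_zero_left h0)
  have h1 : Tendsto (fun z => rieszSum (n + 1) z φ) (𝓝[≠] c) (𝓝 (invPow (n + 1) φ)) := by
    rw [invPow_succ hφ]
    exact tendsto_rieszSum hφ n
  have h2 := tendsto_div_sin_pi_mul.comp hshift
  have h3 : Tendsto (fun z : ℂ => Complex.sin (Real.pi * (z + (n + 1)) / 2) /
      Complex.cos (Real.pi * (z + (n + 1)) / 2)) (𝓝[≠] c) (𝓝 0) := by
    have : ContinuousAt (fun w : ℂ => Complex.sin (Real.pi * w / 2) /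
      Complex.cos (Real.pi * w / 2)) 0 :=
      ContinuousAt.div (by fun_prop) (by fun_prop) (by simp)
    have h4 := this.tendsto
    simp only [mul_zero, zero_div, Complex.sin_zero] at h4
    exact (h4.mono_left nhdsWithin_le_nhds).comp hshift
  have h5 := (tendsto_gammaRatio_mul_two_cpow h).mul
    ((h1.mul h2).sub ((tendsto_mul_rieszPlus hφ n).mul h3))
  rw [mul_zero, sub_zero] at h5
  refine h5.congr' ?_
  have hsin : ∀ᶠ w : ℂ in 𝓝[≠] 0, Complex.sin (Real.pi * w) ≠ 0 := by
    have := tendsto_div_sin_pi_mul.eventually_ne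
      (show (1 / (Real.pi : ℂ)) ≠ 0 from one_div_ne_zero (by exact_mod_cast Real.pi_ne_zero))
    filter_upwards [this] with w hw h0
    rw [h0] at hw
    simp at hw
  filter_upwards [hshift.eventually hsin] with z hz
  set w := z + ((n : ℂ) + 1) with hw
  obtain ⟨es, ec⟩ := sin_cos_pi_mul z (n + 1)
  push_cast at es ec
  rw [← hw] at es ec
  have hd : Real.pi * w = 2 * (Real.pi * w / 2) := by ring
  have hS := Complex.sin_two_mul (Real.pi * w / 2)
  have hC := Complex.cos_two_mul (Real.pi * w / 2)
  have hP := Complex.sin_sq_add_cos_sq (Real.pi * w / 2)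
  rw [← hd] at hS hC
  have hs0 : Complex.sin (Real.pi * w / 2) ≠ 0 := fun h => hz (by rw [hS, h]; ring)
  have hc0 : Complex.cos (Real.pi * w / 2) ≠ 0 := fun h => hz (by rw [hS, h]; ring)
  have hsgn : ((-1 : ℂ) ^ (n + 1)) ≠ 0 := pow_ne_zero _ (by norm_num)
  have hsq : ((-1 : ℂ) ^ (n + 1)) * (-1) ^ (n + 1) = 1 := by rw [← mul_pow]; simp
  rw [kernel, Complex.tan_eq_sin_div_cos, div_div_eq_mul_div, es, ec]
  simp only [Function.comp_apply, rieszSum]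
  rw [hS, hC]
  -- With half-angle sine `S`, cosine `K` and sign `e`, the claim is an algebraic identity modulo
  -- `S² + K² = 1` and `e² = 1`.
  generalize Complex.sin (Real.pi * w / 2) = S at *
  generalize Complex.cos (Real.pi * w / 2) = K at *
  generalize ((-1 : ℂ) ^ (n + 1)) = e at *
  field_simp
  linear_combination gammaRatio m z * w * rieszMinus z φ * hsq -
    2 * gammaRatio m z * w * e * rieszPlus z φ * hP -
    gammaRatio m z * e * (rieszPlus z φ + e * rieszMinus z φ) * hw

/-! ### Local integrability -/

theorem locallyIntegrable_of_norm_le_rpow_add_rpow {f : ℝ → ℂ} (hf : AEStronglyMeasurable f volume)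
    {C a b : ℝ} (ha : -1 < a) (hb : -1 < b)
    (h : ∀ t : ℝ, t ≠ 0 → ‖f t‖ ≤ C * (|t| ^ a + |t| ^ b)) : LocallyIntegrable f volume := by
  have key : ∀ c : ℝ, -1 < c → LocallyIntegrable (fun t : ℝ => |t| ^ c) volume := fun c hc =>
    locallyIntegrable_of_norm_le_rpow (α := -c) (C := 1) (by simp) (by simp; linarith)
      (Eventually.of_forall fun t => by
        rw [one_mul, neg_neg, Real.norm_eq_abs, Real.norm_eq_abs,
          abs_of_nonneg (Real.rpow_nonneg (abs_nonneg t) c)])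
      (by
        have : Measurable fun t : ℝ => |t| ^ c := by fun_prop
        exact this.aestronglyMeasurable)
  have hg : LocallyIntegrable (fun t : ℝ => C * (|t| ^ a + |t| ^ b)) volume :=
    ((key a ha).add (key b hb)).smul C
  refine hg.mono hf ?_
  filter_upwards [compl_mem_ae_iff.2 (measure_singleton (0 : ℝ))] with t ht
  exact (h t ht).trans (le_abs_self _)

/-- Measurable functions bounded by a multiple of `|t|^{-1/2} + |t|^{1/2}`. -/
structure HasRootBound (f : ℝ → ℂ) : Prop where
  aestronglyMeasurable : AEStronglyMeasurable f volume
  bound : ∃ C : ℝ, ∀ t : ℝ, t ≠ 0 → ‖f t‖ ≤ C * (|t| ^ (-(1 / 2) : ℝ) + |t| ^ (1 / 2 : ℝ))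

namespace HasRootBound

theorem add {f g : ℝ → ℂ} (hf : HasRootBound f) (hg : HasRootBound g) :
    HasRootBound (fun t => f t + g t) := by
  obtain ⟨C, hC⟩ := hf.bound
  obtain ⟨D, hD⟩ := hg.bound
  refine ⟨hf.1.add hg.1, C + D, fun t ht => ?_⟩
  rw [add_mul]
  exact (norm_add_le _ _).trans (add_le_add (hC t ht) (hD t ht))

theorem const_mul {f : ℝ → ℂ} (hf : HasRootBound f) (c : ℂ) :
    HasRootBound (fun t => c * f t) := by
  obtain ⟨C, hC⟩ := hf.bound
  refine ⟨hf.1.const_mul c, ‖c‖ * C, fun t ht => ?_⟩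
  rw [norm_mul, mul_assoc]
  exact mul_le_mul_of_nonneg_left (hC t ht) (norm_nonneg _)

theorem comp_neg {f : ℝ → ℂ} (hf : HasRootBound f) : HasRootBound (fun t => f (-t)) := by
  obtain ⟨C, hC⟩ := hf.bound
  refine ⟨hf.1.comp_quasiMeasurePreserving
    (Measure.measurePreserving_neg volume).quasiMeasurePreserving, C, fun t ht => ?_⟩
  simpa using hC (-t) (neg_ne_zero.2 ht)

theorem locallyIntegrable {f : ℝ → ℂ} (hf : HasRootBound f) : LocallyIntegrable f volume := by
  obtain ⟨C, hC⟩ := hf.bound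
  exact locallyIntegrable_of_norm_le_rpow_add_rpow hf.1 (by norm_num) (by norm_num) hC

/-- The worst exponent, `-1/2 - ε`, is still above `-1`. -/
theorem locallyIntegrable_mul_rpow {f : ℝ → ℂ} (hf : HasRootBound f) {ε : ℝ} (hε : ε < 1 / 2) :
    LocallyIntegrable (fun t : ℝ => f t * ((|t| ^ (-ε) : ℝ) : ℂ)) volume := by
  obtain ⟨C, hC⟩ := hf.bound
  have hm : Measurable fun t : ℝ => ((|t| ^ (-ε) : ℝ) : ℂ) := by fun_prop
  refine locallyIntegrable_of_norm_le_rpow_add_rpow (C := C) (a := -(1 / 2) + -ε) (b := 1 / 2 + -ε)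
    (hf.1.mul hm.aestronglyMeasurable) (by linarith) (by linarith) fun t ht => ?_
  have h0 : 0 < |t| := abs_pos.2 ht
  rw [norm_mul, Complex.norm_real, Real.norm_eq_abs, abs_of_nonneg (Real.rpow_nonneg h0.le _),
    Real.rpow_add h0, Real.rpow_add h0, ← add_mul, ← mul_assoc]
  exact mul_le_mul_of_nonneg_right (hC t ht) (Real.rpow_nonneg h0.le _)

theorem integrable_mul {f : ℝ → ℂ} (hf : HasRootBound f) {φ : ℝ → ℂ} (hφ : IsTest φ) :
    Integrable fun t => f t * φ t :=
  hf.locallyIntegrable.integrable_smul_right_of_hasCompactSupport hφ.continuous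
    hφ.hasCompactSupport

theorem isLocallyIntegrableWithPower {f : ℝ → ℂ} (hf : HasRootBound f) {T : (ℝ → ℂ) → ℂ}
    (hT : ∀ φ, IsTest φ → T φ = ∫ t : ℝ, f t * φ t) : IsLocallyIntegrableWithPower T :=
  ⟨f, hf.locallyIntegrable, fun φ => hT φ (isTest_testFunction φ), 1 / 2, by norm_num,
    fun _ _ h => hf.locallyIntegrable_mul_rpow h⟩

end HasRootBound

/-- The superposition `∫ κ(τ) t_+^{L(τ)} dτ` of powers. -/
def powerIntegral (κ : ℝ → ℂ) (L : ℝ → ℂ) (t : ℝ) : ℂ :=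
  (Set.Ioi (0 : ℝ)).indicator (fun t => ∫ τ : ℝ, κ τ * (t : ℂ) ^ L τ) t

theorem norm_cpow_le_of_abs_re_le {t : ℝ} (ht : 0 < t) {z : ℂ} (hz : |z.re| ≤ 1 / 2) :
    ‖(t : ℂ) ^ z‖ ≤ t ^ (-(1 / 2) : ℝ) + t ^ (1 / 2 : ℝ) := by
  rw [Complex.norm_cpow_eq_rpow_re_of_pos ht]
  have h := abs_le.1 hz
  have h1 : 0 ≤ t ^ (-(1 / 2) : ℝ) := Real.rpow_nonneg ht.le _
  have h2 : 0 ≤ t ^ (1 / 2 : ℝ) := Real.rpow_nonneg ht.le _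
  rcases le_total t 1 with h3 | h3
  · linarith [Real.rpow_le_rpow_of_exponent_ge ht h3 h.1]
  · linarith [Real.rpow_le_rpow_of_exponent_le h3 h.2]

theorem aestronglyMeasurable_mul_cpow {κ L : ℝ → ℂ} (hκ : Integrable κ) (hL : Continuous L)
    {μ : Measure ℝ} [SFinite μ] :
    AEStronglyMeasurable (fun p : ℝ × ℝ => κ p.2 * (p.1 : ℂ) ^ L p.2) (μ.prod volume) := by
  have h1 : Measurable fun p : ℝ × ℝ => (p.1 : ℂ) ^ L p.2 :=
    (Complex.measurable_ofReal.comp measurable_fst).pow (hL.measurable.comp measurable_snd)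
  exact hκ.aestronglyMeasurable.comp_snd.mul h1.aestronglyMeasurable

theorem hasRootBound_powerIntegral {κ L : ℝ → ℂ} (hκ : Integrable κ) (hL : Continuous L)
    (hre : ∀ τ, |(L τ).re| ≤ 1 / 2) : HasRootBound (powerIntegral κ L) := by
  refine ⟨?_, ∫ τ, ‖κ τ‖, fun t _ => ?_⟩
  · refine (aestronglyMeasurable_indicator_iff measurableSet_Ioi).2 ?_
    exact (aestronglyMeasurable_mul_cpow hκ hL).integral_prod_right'
  · have h0 : 0 ≤ (∫ τ, ‖κ τ‖) * (|t| ^ (-(1 / 2) : ℝ) + |t| ^ (1 / 2 : ℝ)) := by positivity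
    by_cases ht : t ∈ Set.Ioi (0 : ℝ)
    · rw [powerIntegral, Set.indicator_of_mem ht, ← integral_mul_const]
      refine norm_integral_le_of_norm_le (hκ.norm.mul_const _) (Eventually.of_forall fun τ => ?_)
      rw [norm_mul, abs_of_pos ht]
      exact mul_le_mul_of_nonneg_left (norm_cpow_le_of_abs_re_le ht (hre τ)) (norm_nonneg _)
    · rw [powerIntegral, Set.indicator_of_notMem ht, norm_zero]
      exact h0

/-- Since `Re L ≥ -1/2 > -1`, the pairing is a convergent integral with no integration by parts.
Fubini applies with majorant `‖κ(τ)‖ (t^{-1/2} + t^{1/2}) ‖φ(t)‖`. -/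
theorem integral_mul_rieszPlus {κ L : ℝ → ℂ} (hκ : Integrable κ) (hL : Continuous L)
    (hre : ∀ τ, |(L τ).re| ≤ 1 / 2) {φ : ℝ → ℂ} (hφ : IsTest φ) :
    ∫ τ, κ τ * rieszPlus (L τ) φ = ∫ t, powerIntegral κ L t * φ t := by
  have e1 (τ : ℝ) : κ τ * rieszPlus (L τ) φ =
      ∫ t in Set.Ioi (0 : ℝ), κ τ * (t : ℂ) ^ L τ * φ t := by
    have := (abs_le.1 (hre τ)).1
    rw [rieszPlus_eq_rieszAux hφ (n := 0) (by simp; linarith), rieszAux]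
    simp only [pow_zero, Finset.range_zero, Finset.prod_empty, div_one, one_mul, Nat.cast_zero,
      add_zero, iteratedDeriv_zero]
    rw [mellin_eq_setIntegral, ← integral_const_mul]
    simp only [mul_assoc]
  have e2 : ∫ t, powerIntegral κ L t * φ t =
      ∫ t in Set.Ioi (0 : ℝ), ∫ τ, κ τ * (t : ℂ) ^ L τ * φ t := by
    rw [← integral_indicator measurableSet_Ioi]
    congr 1
    ext t
    by_cases ht : t ∈ Set.Ioi (0 : ℝ)
    · rw [powerIntegral, Set.indicator_of_mem ht, Set.indicator_of_mem ht, integral_mul_const]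
    · rw [powerIntegral, Set.indicator_of_notMem ht, Set.indicator_of_notMem ht, zero_mul]
  simp only [e1]
  rw [e2, ← integral_integral_swap]
  have hw : IntegrableOn (fun t : ℝ => (|t| ^ (-(1 / 2) : ℝ) + |t| ^ (1 / 2 : ℝ)) * ‖φ t‖)
      (Set.Ioi 0) := by
    have hb : HasRootBound (fun t : ℝ => ((|t| ^ (-(1 / 2) : ℝ) + |t| ^ (1 / 2 : ℝ) : ℝ) : ℂ)) := by
      refine ⟨?_, 1, fun t _ => ?_⟩
      · have : Measurable fun t : ℝ => ((|t| ^ (-(1 / 2) : ℝ) + |t| ^ (1 / 2 : ℝ) : ℝ) : ℂ) := by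
          fun_prop
        exact this.aestronglyMeasurable
      · rw [Complex.norm_real, Real.norm_eq_abs, abs_of_nonneg (by positivity), one_mul]
    refine ((hb.integrable_mul hφ).norm.integrableOn).congr_fun (fun t _ => ?_) measurableSet_Ioi
    simp only [norm_mul, Complex.norm_real, Real.norm_eq_abs]
    rw [abs_of_nonneg (by positivity)]
  have hprod := hw.mul_prod hκ.norm
  refine hprod.mono' ?_ ?_
  · have hφm : AEStronglyMeasurable φ (volume.restrict (Set.Ioi 0)) :=
      hφ.continuous.aestronglyMeasurable
    exact (aestronglyMeasurable_mul_cpow hκ hL).mul hφm.comp_fst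
  · have hae : ∀ᵐ p : ℝ × ℝ ∂((volume.restrict (Set.Ioi 0)).prod volume), 0 < p.1 := by
      have h := Measure.quasiMeasurePreserving_fst (μ := volume.restrict (Set.Ioi (0 : ℝ)))
        (ν := (volume : Measure ℝ))
      exact h.ae (ae_restrict_mem measurableSet_Ioi)
    filter_upwards [hae] with p hp
    simp only [Function.uncurry]
    rw [norm_mul, norm_mul, abs_of_pos hp]
    have := norm_cpow_le_of_abs_re_le hp (hre p.2)
    calc _ ≤ ‖κ p.2‖ * (p.1 ^ (-(1 / 2) : ℝ) + p.1 ^ (1 / 2 : ℝ)) * ‖φ p.1‖ := by gcongr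
      _ = _ := by ring

/-! ### A contour on which the integrals converge pointwise -/

/-- A smooth bump function equal to `1` at `0` and vanishing for `|τ| ≥ 1`. -/
def contourBump : ContDiffBump (0 : ℝ) := ⟨1 / 2, 1, by norm_num, by norm_num⟩

/-- A smooth contour through `-1/2` which is the line `Re z = 1/2` for `|Im z| ≥ 1`. -/
def rootContour (τ : ℝ) : ℂ := ((1 / 2 - contourBump τ : ℝ) : ℂ) + τ * Complex.I

theorem rootContour_re (τ : ℝ) : (rootContour τ).re = 1 / 2 - contourBump τ := by
  simp [rootContour]

theorem rootContour_im (τ : ℝ) : (rootContour τ).im = τ := by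
  simp [rootContour]

theorem abs_rootContour_re_le (τ : ℝ) : |(rootContour τ).re| ≤ 1 / 2 := by
  rw [rootContour_re, abs_le]
  have h1 := contourBump.nonneg (x := τ)
  have h2 := contourBump.le_one (x := τ)
  constructor <;> linarith

theorem contourBump_eq_zero {τ : ℝ} (h : 1 ≤ |τ|) : contourBump τ = 0 :=
  contourBump.zero_of_le_dist (by simpa [contourBump] using h)

theorem hasDerivAt_rootContour (τ : ℝ) :
    HasDerivAt rootContour (((-deriv contourBump τ : ℝ) : ℂ) + Complex.I) τ := by
  have h1 : HasDerivAt (fun τ => 1 / 2 - contourBump τ) (-deriv contourBump τ) τ :=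
    ((contourBump.contDiff (n := 1)).differentiable one_ne_zero τ).hasDerivAt.const_sub _
  have h2 := (hasDerivAt_id τ).ofReal_comp.mul_const Complex.I
  exact (h1.ofReal_comp.add h2).congr_deriv (by simp)

theorem continuous_deriv_rootContour : Continuous (deriv rootContour) := by
  rw [show deriv rootContour = _ from funext fun τ => (hasDerivAt_rootContour τ).deriv]
  have := (contourBump.contDiff (n := 1)).continuous_deriv le_rfl
  fun_prop

theorem exists_norm_deriv_rootContour_le : ∃ B : ℝ, ∀ τ, ‖deriv rootContour τ‖ ≤ B := by
  obtain ⟨C, hC⟩ := ((contourBump.contDiff (n := 1)).continuous_deriv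
    le_rfl).bounded_above_of_compact_support contourBump.hasCompactSupport.deriv
  refine ⟨C + 1, fun τ => ?_⟩
  rw [(hasDerivAt_rootContour τ).deriv]
  refine (norm_add_le _ _).trans (add_le_add ?_ (by simp))
  rw [Complex.norm_real, norm_neg]
  exact hC τ

theorem continuous_rootContour : Continuous rootContour :=
  continuous_iff_continuousAt.2 fun τ => (hasDerivAt_rootContour τ).continuousAt

theorem isContour_rootContour : IsContour (1 / 2) (-(1 / 2)) rootContour where
  continuous := continuous_rootContour
  piecewise_contDiff := by
    refine ⟨∅, Set.finite_empty, fun τ _ => ContDiff.contDiffAt ?_⟩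
    exact contDiff_one_iff_deriv.2 ⟨fun τ => (hasDerivAt_rootContour τ).differentiableAt,
      continuous_deriv_rootContour⟩
  bounded_deriv := exists_norm_deriv_rootContour_le
  zero := by
    have : contourBump 0 = 1 := contourBump.one_of_mem_closedBall (by simp [contourBump])
    rw [rootContour, this]
    norm_num
  im_pos τ h := by rwa [rootContour_im]
  im_neg τ h := by rwa [rootContour_im]
  tendsto_re := by
    refine tendsto_const_nhds.congr' ?_
    filter_upwards [eventually_cocompact_le_abs 1] with τ hτ
    rw [rootContour_re, contourBump_eq_zero hτ, sub_zero]
  im_growth := ⟨1, one_pos, Eventually.of_forall fun τ => by rw [rootContour_im, one_mul]⟩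

theorem rootContour_ne_intCast (τ : ℝ) (n : ℤ) : rootContour τ ≠ n := by
  have := isContour_rootContour.ne_ofReal (a := n) (fun h => ?_) τ
  · simpa using this
  · have h1 : ((2 * n + 1 : ℤ) : ℝ) = 0 := by push_cast; linarith
    have h2 : 2 * n + 1 = 0 := by exact_mod_cast h1
    omega

theorem integrable_of_eventually_norm_le {g : ℝ → ℂ} (hg : Continuous g) {K : ℝ}
    (h : ∀ᶠ τ in cocompact ℝ, ‖g τ‖ ≤ K * (|τ| ^ 2)⁻¹) : Integrable g := by
  have h1 : ∀ᶠ τ in cocompact ℝ, |(1 + τ ^ 2) * ‖g τ‖| ≤ 2 * K := by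
    filter_upwards [h, eventually_cocompact_le_abs 1] with τ h1 h2
    rw [abs_of_nonneg (by positivity)]
    have h6 : 1 + τ ^ 2 ≤ 2 * |τ| ^ 2 := by rw [← sq_abs τ]; nlinarith
    have h7 : |τ| ≠ 0 := by positivity
    calc (1 + τ ^ 2) * ‖g τ‖ ≤ (2 * |τ| ^ 2) * (K * (|τ| ^ 2)⁻¹) := by gcongr
      _ = _ := by field_simp
  have hgc : Continuous fun τ : ℝ => (1 + τ ^ 2) * ‖g τ‖ := by fun_prop
  obtain ⟨M, hM⟩ := exists_bound_of_eventually_cocompact hgc h1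
  refine (integrable_inv_one_add_sq.const_mul M).mono' hg.aestronglyMeasurable
    (Eventually.of_forall fun τ => ?_)
  have h2 := hM τ
  rw [abs_of_nonneg (by positivity)] at h2
  rw [← div_eq_mul_inv, le_div_iff₀ (by positivity)]
  linarith

/-- The density of the integrand on `rootContour`, with an additional factor `q`. -/
def rootDensity (m : ℕ) (q : ℂ → ℂ) (τ : ℝ) : ℂ :=
  gammaRatio m (rootContour τ) * (2 : ℂ) ^ rootContour τ * q (rootContour τ) * deriv rootContour τ

theorem integrable_rootDensity (m : ℕ) {q : ℂ → ℂ} (hq : ∀ z : ℂ, 1 ≤ |z.im| → ‖q z‖ ≤ 2)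
    (hqc : ∀ z : ℂ, (∀ n : ℤ, z ≠ n) → ContinuousAt q z) : Integrable (rootDensity m q) := by
  obtain ⟨B, hB⟩ := exists_norm_deriv_rootContour_le
  have hB0 : 0 ≤ B := (norm_nonneg _).trans (hB 0)
  have hcomp : ∀ p : ℂ → ℂ, (∀ z : ℂ, (∀ n : ℤ, z ≠ n) → ContinuousAt p z) →
      Continuous fun τ => p (rootContour τ) := fun p hp =>
    continuous_iff_continuousAt.2 fun τ => ContinuousAt.comp (g := p)
      (hp _ (rootContour_ne_intCast τ)) continuous_rootContour.continuousAt
  have hc : Continuous (rootDensity m q) := by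
    refine Continuous.mul (Continuous.mul (Continuous.mul (hcomp _ fun z hz => ?_)
      (hcomp (fun z => (2 : ℂ) ^ z) fun z _ => (differentiableAt_two_cpow z).continuousAt))
      (hcomp q hqc)) continuous_deriv_rootContour
    exact (differentiableAt_gammaRatio m fun n => by simpa using hz n).continuousAt
  -- The factors of the constant bound `|2^z|`, `|q|` and the speed of the contour.
  refine integrable_of_eventually_norm_le hc (K := 2 * 2 * B) ?_
  filter_upwards [eventually_cocompact_le_abs 1] with τ hτ
  have hre : (rootContour τ).re = 1 / 2 := by
    rw [rootContour_re, contourBump_eq_zero hτ, sub_zero]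
  have him : 1 ≤ |(rootContour τ).im| := by rwa [rootContour_im]
  have h1 := norm_gammaRatio_le_inv_sq m hre him
  rw [rootContour_im] at h1
  have h2 : ‖(2 : ℂ) ^ rootContour τ‖ ≤ 2 := by
    have e : ((2 : ℝ) : ℂ) = 2 := by norm_num
    rw [← e, Complex.norm_cpow_eq_rpow_re_of_pos two_pos, hre]
    calc (2 : ℝ) ^ (1 / 2 : ℝ) ≤ 2 ^ (1 : ℝ) :=
          Real.rpow_le_rpow_of_exponent_le one_le_two (by norm_num)
      _ = 2 := Real.rpow_one 2
  calc ‖rootDensity m q τ‖ = ‖gammaRatio m (rootContour τ)‖ * ‖(2 : ℂ) ^ rootContour τ‖ *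
        ‖q (rootContour τ)‖ * ‖deriv rootContour τ‖ := by
        rw [rootDensity, norm_mul, norm_mul, norm_mul]
    _ ≤ (|τ| ^ 2)⁻¹ * 2 * 2 * B := by
        gcongr
        · exact hq _ him
        · exact hB τ
    _ = _ := by ring

/-- Mellin–Barnes integrals along `rootContour` are given by functions. -/
theorem exists_hasRootBound_contourIntegral (m : ℕ) {q : ℂ → ℂ}
    (hq : ∀ z : ℂ, 1 ≤ |z.im| → ‖q z‖ ≤ 2)
    (hqc : ∀ z : ℂ, (∀ n : ℤ, z ≠ n) → ContinuousAt q z) :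
    ∃ f : ℝ → ℂ, HasRootBound f ∧ ∀ φ, IsTest φ →
      contourIntegral rootContour (fun z => kernelPlus m φ z * q z) = ∫ t, f t * φ t := by
  have hκ := integrable_rootDensity m hq hqc
  refine ⟨fun t => 1 / (2 * Real.pi * Complex.I) * powerIntegral (rootDensity m q) rootContour t,
    (hasRootBound_powerIntegral hκ continuous_rootContour abs_rootContour_re_le).const_mul _,
    fun φ hφ => ?_⟩
  simp only [mul_assoc (1 / (2 * (Real.pi : ℂ) * Complex.I))]
  rw [contourIntegral, integral_const_mul, ← integral_mul_rieszPlus hκ continuous_rootContour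
    abs_rootContour_re_le hφ]
  congr 2
  ext τ
  rw [kernelPlus, rootDensity]
  ring

theorem contourIntegral_eq_rootContour {γ₀ s₀ : ℝ} {L₀ : ℝ → ℂ} (hL₀ : IsContour γ₀ s₀ L₀)
    (hs₀ : -1 < s₀) (hs₀' : s₀ < 0) {F : ℂ → ℂ}
    (hF : ∀ z : ℂ, (∀ n : ℤ, z ≠ n) → DifferentiableAt ℂ F z) (hd : HasStripDecay F) :
    contourIntegral L₀ F = contourIntegral rootContour F := by
  refine contourIntegral_eq_of_slitDomain hL₀ isContour_rootContour hs₀ hs₀' (by norm_num)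
    (by norm_num) (fun z hz => (hF z ?_).differentiableWithinAt) hd
  -- With `m = 0` the gap is `(-1, 0)`, which contains no integers to exclude.
  refine ne_intCast_of_mem_slitDomain (m := 0) (by simpa using hz) ?_
  simp

theorem exists_hasRootBound_besselPlus (m : ℕ) {γ₀ s₀ : ℝ} {L₀ : ℝ → ℂ}
    (hL₀ : IsContour γ₀ s₀ L₀) (hs₀ : -1 < s₀) (hs₀' : s₀ < 0) :
    ∃ f : ℝ → ℂ, HasRootBound f ∧ ∀ φ, IsTest φ → besselPlus m L₀ φ = ∫ t, f t * φ t := by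
  obtain ⟨f, hf, h⟩ := exists_hasRootBound_contourIntegral m (q := fun _ => 1)
    (fun z _ => by simp) (fun z _ => continuousAt_const)
  refine ⟨f, hf, fun φ hφ => ?_⟩
  rw [← h φ hφ, besselPlus, contourIntegral_eq_rootContour hL₀ hs₀ hs₀'
    (fun z hz => differentiableAt_kernelPlus m hφ hz) (hasStripDecay_kernelPlus m hφ)]
  simp only [mul_one]

theorem exists_hasRootBound_bessel (m : ℕ) {γ₀ s₀ : ℝ} {L₀ : ℝ → ℂ}
    (hL₀ : IsContour γ₀ s₀ L₀) (hs₀ : -1 < s₀) (hs₀' : s₀ < 0) :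
    ∃ f : ℝ → ℂ, HasRootBound f ∧ ∀ φ, IsTest φ → bessel m L₀ φ = ∫ t, f t * φ t := by
  have hsin : Continuous fun z : ℂ => Complex.sin (Real.pi * z) := by fun_prop
  have hcos : Continuous fun z : ℂ => Complex.cos (Real.pi * z) := by fun_prop
  have q1c : ∀ z : ℂ, (∀ n : ℤ, z ≠ n) → ContinuousAt
      (fun z : ℂ => Complex.cos (Real.pi * z) / Complex.sin (Real.pi * z)) z := fun z hz =>
    hcos.continuousAt.div hsin.continuousAt (sin_pi_mul_ne_zero hz)
  have q2c : ∀ z : ℂ, (∀ n : ℤ, z ≠ n) → ContinuousAt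
      (fun z : ℂ => 1 / Complex.sin (Real.pi * z)) z := fun z hz =>
    continuousAt_const.div hsin.continuousAt (sin_pi_mul_ne_zero hz)
  obtain ⟨f, hf, h⟩ := exists_hasRootBound_contourIntegral m
    (fun z => norm_cos_div_sin_pi_mul_le) q1c
  obtain ⟨g, hg, h'⟩ := exists_hasRootBound_contourIntegral m
    (fun z => norm_one_div_sin_pi_mul_le) q2c
  -- The `t_-^z` part is represented by `g` against the reflected test function; substituting `t ↦
  -- -t` moves the reflection onto `g`.
  refine ⟨fun t => f t + g (-t), hf.add hg.comp_neg, fun φ hφ => ?_⟩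
  rw [bessel, contourIntegral_eq_rootContour hL₀ hs₀ hs₀'
    (fun z hz => differentiableAt_kernel m hφ hz) (hasStripDecay_kernel m hφ),
    show kernel m φ = _ from funext (kernel_eq m φ), contourIntegral_add, h φ hφ,
    h' _ hφ.comp_neg]
  · simp only [add_mul]
    rw [integral_add (hf.integrable_mul hφ) (hg.comp_neg.integrable_mul hφ)]
    congr 1
    have := integral_neg_eq_self (fun t => g (-t) * φ t) volume
    rw [← this]
    simp
  · refine isContour_rootContour.contourIntegrable ?_
      (hasStripDecay_kernelPlus_mul m hφ fun z => norm_cos_div_sin_pi_mul_le)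
    exact continuous_iff_continuousAt.2 fun τ => ContinuousAt.comp
      (g := fun z => kernelPlus m φ z * (Complex.cos (Real.pi * z) / Complex.sin (Real.pi * z)))
      ((differentiableAt_kernelPlus m hφ (rootContour_ne_intCast τ)).continuousAt.mul
        (q1c _ (rootContour_ne_intCast τ))) continuous_rootContour.continuousAt
  · refine isContour_rootContour.contourIntegrable ?_
      (hasStripDecay_kernelPlus_mul m hφ.comp_neg fun z => norm_one_div_sin_pi_mul_le)
    exact continuous_iff_continuousAt.2 fun τ => ContinuousAt.comp
      (g := fun z => kernelPlus m (fun x => φ (-x)) z * (1 / Complex.sin (Real.pi * z)))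
      ((differentiableAt_kernelPlus m hφ.comp_neg (rootContour_ne_intCast τ)).continuousAt.mul
        (q2c _ (rootContour_ne_intCast τ))) continuous_rootContour.continuousAt

/-! ### Extension to functions of finite differentiability -/

/-- Each differentiation lowers the regularity class by one, so the induction on `k` must leave `n`
free. -/
theorem exists_iteratedDerivCLM (k : ℕ) : ∀ {n : ℕ}, k ≤ n →
    ∃ D : 𝓓^{(n : ℕ∞)}((⊤ : TopologicalSpace.Opens ℝ), ℂ) →L[ℂ]
        𝓓^{(0 : ℕ∞)}((⊤ : TopologicalSpace.Opens ℝ), ℂ),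
      ∀ ψ, (D ψ : ℝ → ℂ) = iteratedDeriv k ψ := by
  induction k with
  | zero =>
    intro n _
    exact ⟨TestFunction.monoCLM ℂ, fun ψ => by rw [TestFunction.monoCLM_apply]; simp⟩
  | succ k ih =>
    intro n hn
    obtain ⟨n, rfl⟩ : ∃ j, n = j + 1 := ⟨n - 1, by omega⟩
    obtain ⟨D, hD⟩ := ih (n := n) (by omega)
    refine ⟨D.comp (TestFunction.lineDerivCLM ℂ (1 : ℝ)), fun ψ => ?_⟩
    rw [ContinuousLinearMap.comp_apply, hD, iteratedDeriv_succ']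
    congr 1
    ext x
    rw [TestFunction.lineDerivCLM_apply_of_le (by push_cast; exact le_rfl)]
    simp [lineDeriv, deriv_comp_const_add]

namespace ExtendsToContDiff

variable {n : ℕ} {T T' : (ℝ → ℂ) → ℂ}

theorem congr (h : ExtendsToContDiff n T) (hT : ∀ φ, IsTest φ → T' φ = T φ) :
    ExtendsToContDiff n T' := by
  obtain ⟨S, hS⟩ := h
  exact ⟨S, fun φ ψ hψ => by rw [hS φ ψ hψ, hT φ (isTest_testFunction φ)]⟩

theorem sub (h : ExtendsToContDiff n T) (h' : ExtendsToContDiff n T') :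
    ExtendsToContDiff n (fun φ => T φ - T' φ) := by
  obtain ⟨S, hS⟩ := h
  obtain ⟨S', hS'⟩ := h'
  exact ⟨S - S', fun φ ψ hψ => by rw [sub_apply, hS φ ψ hψ, hS' φ ψ hψ]⟩

theorem const_mul (h : ExtendsToContDiff n T) (c : ℂ) :
    ExtendsToContDiff n (fun φ => c * T φ) := by
  obtain ⟨S, hS⟩ := h
  exact ⟨c • S, fun φ ψ hψ => by rw [smul_apply, hS φ ψ hψ, smul_eq_mul]⟩

theorem sum {ι : Type*} (s : Finset ι) {T : ι → (ℝ → ℂ) → ℂ}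
    (h : ∀ i ∈ s, ExtendsToContDiff n (T i)) :
    ExtendsToContDiff n (fun φ => ∑ i ∈ s, T i φ) := by
  choose! S hS using h
  refine ⟨∑ i ∈ s, S i, fun φ ψ hψ => ?_⟩
  rw [sum_apply]
  exact Finset.sum_congr rfl fun i hi => hS i hi φ ψ hψ

end ExtendsToContDiff

theorem extendsToContDiff_iteratedDeriv_zero {k n : ℕ} (hk : k ≤ n) :
    ExtendsToContDiff n (fun φ => iteratedDeriv k φ 0) := by
  obtain ⟨D, hD⟩ := exists_iteratedDerivCLM k hk
  let ev : 𝓓^{(0 : ℕ∞)}((⊤ : TopologicalSpace.Opens ℝ), ℂ) →L[ℂ] ℂ :=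
    { toFun := fun ψ => ψ 0
      map_add' := fun _ _ => rfl
      map_smul' := fun _ _ => rfl
      cont := continuous_eval_const 0 }
  refine ⟨ev.comp D, fun φ ψ hψ => ?_⟩
  change (D ψ) 0 = _
  rw [hD, hψ]

theorem extendsToContDiff_integral {f : ℝ → ℂ} (hf : LocallyIntegrable f volume) {k n : ℕ}
    (hk : k ≤ n) : ExtendsToContDiff n (fun φ => ∫ t, f t * iteratedDeriv k φ t) := by
  obtain ⟨D, hD⟩ := exists_iteratedDerivCLM k hk
  refine ⟨(TestFunction.integralAgainstBilinCLM (ContinuousLinearMap.mul ℂ ℂ) volume f).comp D,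
    fun φ ψ hψ => ?_⟩
  rw [ContinuousLinearMap.comp_apply,
    TestFunction.integralAgainstBilinCLM_eq_integral (hf.locallyIntegrableOn _), hD, hψ]
  simp only [ContinuousLinearMap.mul_apply', mul_comm]

/-- The representation by the locally integrable `log |t|` against `φ^(k)` involves no derivative
beyond order `k`. -/
theorem extendsToContDiff_invPow {k n : ℕ} (hk : 1 ≤ k) (hkn : k ≤ n) :
    ExtendsToContDiff n (invPow k) := by
  obtain ⟨j, rfl⟩ : ∃ j, k = j + 1 := ⟨k - 1, by omega⟩
  have hlog : LocallyIntegrable (fun t : ℝ => (Real.log t : ℂ)) volume := fun x =>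
    (locallyIntegrable_log x).imp fun s hs => ⟨hs.1, Integrable.ofReal hs.2⟩
  refine ((extendsToContDiff_integral hlog hkn).const_mul (-1 / j.factorial)).congr fun φ hφ => ?_
  rw [invPow_succ hφ]
  simp only [Complex.real_smul]

theorem HasRootBound.extendsToContDiff {f : ℝ → ℂ} (hf : HasRootBound f) {T : (ℝ → ℂ) → ℂ}
    (hT : ∀ φ, IsTest φ → T φ = ∫ t : ℝ, f t * φ t) (n : ℕ) : ExtendsToContDiff n T :=
  (extendsToContDiff_integral hf.locallyIntegrable n.zero_le).congr fun φ hφ => by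
    rw [hT φ hφ]; simp only [iteratedDeriv_zero]

/-! ### Shifting the contour -/

theorem besselPlus_shift {m : ℕ} {γ s γ₀ s₀ : ℝ} {L L₀ : ℝ → ℂ}
    (hL : IsContour γ s L) (hs : -(m : ℝ) - 1 < s) (hs' : s < -(m : ℝ))
    (hL₀ : IsContour γ₀ s₀ L₀) (hs₀ : -1 < s₀) (hs₀' : s₀ < 0) {φ : ℝ → ℂ} (hφ : IsTest φ) :
    ContourIntegrable L (kernelPlus m φ) ∧ ContourIntegrable L₀ (kernelPlus m φ) ∧
      besselPlus m L φ = besselPlus m L₀ φ -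
        ∑ k ∈ Finset.Icc 1 m, (-1 : ℂ) ^ (k - 1) / (2 ^ k * ((m - k).factorial : ℂ)) *
          diracDeriv (k - 1) φ := by
  refine contourIntegral_shift hL hs hs' hL₀ hs₀ hs₀'
    (fun z hz h => differentiableAt_kernelPlus m hφ (ne_intCast_of_mem_slitDomain hz h))
    (fun k hk => ?_) (hasStripDecay_kernelPlus m hφ)
  obtain ⟨h1, h2⟩ := Finset.mem_Icc.1 hk
  obtain ⟨n, rfl⟩ : ∃ j, k = j + 1 := ⟨k - 1, by omega⟩
  have h := tendsto_mul_kernelPlus h2 hφ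
  have hsq : ((-1 : ℂ) ^ n) * (-1) ^ n = 1 := by rw [← mul_pow]; simp
  -- The sign in the coefficient cancels the one in the definition of `δ^(k-1)`.
  rw [diracDeriv, Nat.add_sub_cancel, div_mul_eq_mul_div, ← mul_assoc, hsq, one_mul]
  push_cast
  exact h

theorem bessel_shift {m : ℕ} {γ s γ₀ s₀ : ℝ} {L L₀ : ℝ → ℂ}
    (hL : IsContour γ s L) (hs : -(m : ℝ) - 1 < s) (hs' : s < -(m : ℝ))
    (hL₀ : IsContour γ₀ s₀ L₀) (hs₀ : -1 < s₀) (hs₀' : s₀ < 0) {φ : ℝ → ℂ} (hφ : IsTest φ) :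
    ContourIntegrable L (kernel m φ) ∧ ContourIntegrable L₀ (kernel m φ) ∧
      bessel m L φ = bessel m L₀ φ - 1 / (Real.pi : ℂ) * ∑ k ∈ Finset.Icc 1 m,
        ((k - 1).factorial : ℂ) / (2 ^ k * ((m - k).factorial : ℂ)) * invPow k φ := by
  rw [Finset.mul_sum]
  refine contourIntegral_shift hL hs hs' hL₀ hs₀ hs₀'
    (fun z hz h => differentiableAt_kernel m hφ (ne_intCast_of_mem_slitDomain hz h))
    (fun k hk => ?_) (hasStripDecay_kernel m hφ)
  obtain ⟨h1, h2⟩ := Finset.mem_Icc.1 hk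
  obtain ⟨n, rfl⟩ : ∃ j, k = j + 1 := ⟨k - 1, by omega⟩
  have h := tendsto_mul_kernel h2 hφ
  rw [Nat.add_sub_cancel]
  push_cast
  convert h using 2
  ring

end MellinBarnes

end

/-! ### Assembly of the theorem -/

theorem mainTheorem11 (m : ℕ) (γ s γ₀ s₀ : ℝ) (L L₀ : ℝ → ℂ)
    (hL : MellinBarnes.IsContour γ s L) (hγ : -1 < γ)
    (hs : -(m : ℝ) - 1 < s) (hs' : s < -(m : ℝ))
    (hL₀ : MellinBarnes.IsContour γ₀ s₀ L₀) (hγ₀ : -1 < γ₀)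
    (hs₀ : -1 < s₀) (hs₀' : s₀ < 0) :
    -- the four integrals converge absolutely against every test function
    (∀ φ : 𝓓((⊤ : TopologicalSpace.Opens ℝ), ℂ),
      MellinBarnes.ContourIntegrable L₀ (MellinBarnes.kernelPlus m φ) ∧
      MellinBarnes.ContourIntegrable L (MellinBarnes.kernelPlus m φ) ∧
      MellinBarnes.ContourIntegrable L₀ (MellinBarnes.kernel m φ) ∧
      MellinBarnes.ContourIntegrable L (MellinBarnes.kernel m φ)) ∧
    -- local integrability of `Φ_m^+` and `Φ_m`, also after multiplication by `|t|^{-ε}`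
    MellinBarnes.IsLocallyIntegrableWithPower (MellinBarnes.besselPlus m L₀) ∧
    MellinBarnes.IsLocallyIntegrableWithPower (MellinBarnes.bessel m L₀) ∧
    -- `Ψ_m^+` in terms of `Φ_m^+`
    (∀ φ : 𝓓((⊤ : TopologicalSpace.Opens ℝ), ℂ),
      MellinBarnes.besselPlus m L φ = MellinBarnes.besselPlus m L₀ φ -
        ∑ k ∈ Finset.Icc 1 m, (-1 : ℂ) ^ (k - 1) / (2 ^ k * ((m - k).factorial : ℂ)) *
          MellinBarnes.diracDeriv (k - 1) φ) ∧
    -- the limit that defines `t^{-k}` exists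
    (∀ k : ℕ, 1 ≤ k → ∀ φ : 𝓓((⊤ : TopologicalSpace.Opens ℝ), ℂ),
      Tendsto (fun z : ℂ => MellinBarnes.rieszSum k z φ) (𝓝[≠] (-(k : ℂ)))
        (𝓝 (MellinBarnes.invPow k φ))) ∧
    -- `Ψ_m` in terms of `Φ_m`
    (∀ φ : 𝓓((⊤ : TopologicalSpace.Opens ℝ), ℂ),
      MellinBarnes.bessel m L φ = MellinBarnes.bessel m L₀ φ -
        1 / (Real.pi : ℂ) * ∑ k ∈ Finset.Icc 1 m,
          ((k - 1).factorial : ℂ) / (2 ^ k * ((m - k).factorial : ℂ)) *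
            MellinBarnes.invPow k φ) ∧
    -- extension to functions of finite differentiability
    (1 ≤ m → MellinBarnes.ExtendsToContDiff (m - 1) (MellinBarnes.besselPlus m L)) ∧
    MellinBarnes.ExtendsToContDiff m (MellinBarnes.bessel m L) := by
  obtain ⟨f, hf, hfT⟩ := MellinBarnes.exists_hasRootBound_besselPlus m hL₀ hs₀ hs₀'
  obtain ⟨g, hg, hgT⟩ := MellinBarnes.exists_hasRootBound_bessel m hL₀ hs₀ hs₀'
  have hP := fun φ (hφ : MellinBarnes.IsTest φ) =>
    MellinBarnes.besselPlus_shift hL hs hs' hL₀ hs₀ hs₀' hφ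
  have hB := fun φ (hφ : MellinBarnes.IsTest φ) =>
    MellinBarnes.bessel_shift hL hs hs' hL₀ hs₀ hs₀' hφ
  refine ⟨fun φ => ?_, hf.isLocallyIntegrableWithPower hfT, hg.isLocallyIntegrableWithPower hgT,
    fun φ => (hP φ (MellinBarnes.isTest_testFunction φ)).2.2, fun k hk φ => ?_,
    fun φ => (hB φ (MellinBarnes.isTest_testFunction φ)).2.2, fun hm => ?_, ?_⟩
  · have hφ := MellinBarnes.isTest_testFunction φ
    exact ⟨(hP φ hφ).2.1, (hP φ hφ).1, (hB φ hφ).2.1, (hB φ hφ).1⟩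
  · have hφ := MellinBarnes.isTest_testFunction φ
    obtain ⟨n, rfl⟩ : ∃ j, k = j + 1 := ⟨k - 1, by omega⟩
    rw [MellinBarnes.invPow_succ hφ]
    have h := MellinBarnes.tendsto_rieszSum hφ n
    push_cast
    exact h
  · refine ((hf.extendsToContDiff hfT (m - 1)).sub (MellinBarnes.ExtendsToContDiff.sum
      (Finset.Icc 1 m) fun k hk => ?_)).congr fun φ hφ => (hP φ hφ).2.2
    have := Finset.mem_Icc.1 hk
    -- The orders `k - 1` of the delta terms do not exceed `m - 1`.
    exact ((MellinBarnes.extendsToContDiff_iteratedDeriv_zero (k := k - 1)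
      (by omega)).const_mul _).const_mul _
  · refine ((hg.extendsToContDiff hgT m).sub ((MellinBarnes.ExtendsToContDiff.sum
      (Finset.Icc 1 m) fun k hk => ?_).const_mul _)).congr fun φ hφ => (hB φ hφ).2.2
    obtain ⟨h1, h2⟩ := Finset.mem_Icc.1 hk
    exact (MellinBarnes.extendsToContDiff_invPow h1 h2).const_mul _
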